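/- **Setting.** Let $K\ge 1$. For each $k\in[K]=\{1,\dots,K\}$ let $f_0^k,f_1^k$ be probability densities with respect to a $\sigma$-finite measure $\mu^k$ whose laws are mutually absolutely continuous, such that $$D_0^k=\int \log\Big(\tfrac{f_0^k}{f_1^k}\Big)f_0^k\,d\mu^k,\qquad D_1^k=\int \log\Big(\tfrac{f_1^k}{f_0^k}\Big)f_1^k\,d\mu^k$$ are positive and finite, and $\int(\log (f_0^k/f_1^k))^2f_i^k\,d\mu^k<\infty$ for $i=0,1$. For $\mathcal A\subset[K]$, under $\mathsf P_{\mathcal A}$ all observations $X_n^k$ ($n\ge1$, $k\in[K]$) are independent, and $X_n^k$ has density $f_1^k$ if $k\in\mathcal A$ and $f_0^k$ if $k\notin\mathcal A$; $\mathsf E_{\mathcal A}$ is the expectation under $\mathsf P_{\mathcal A}$. Put $\lambda^k(n)=\sum_{j=1}^n\log\frac{f_1^k(X_j^k)}{f_0^k(X_j^k)}$, $\mathcal F_n=\sigma(X_j^k: j\le n,\,k\in[K])$, $\eta_1^{\mathcal A}=\min_{k\in\mathcal A}D_1^k$ and $\eta_0^{\mathcal A}=\min_{k\notin\mathcal A}D_0^k$,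 with $\min\emptyset=\infty$. A sequential test is a pair $(T,d)$ of an $\{\mathcal F_n\}$-stopping time $T\ge 1$ and an $\mathcal F_T$-measurable random set $d\subset[K]$. For a class $\mathcal P$ of subsets of $[K]$, $\Delta_{\alpha,\beta}(\mathcal P)$ is the set of sequential tests such that $\mathsf P_{\mathcal A}(d\setminus\mathcal A\ne\emptyset)\le\alpha$ and $\mathsf P_{\mathcal A}(\mathcal A\setminus d\neq\emptyset)\le\beta$ for all $\mathcal A\in\mathcal P$. Let $\mathcal P_m=\{\mathcal A:|\mathcal A|=m\}$ and $\mathcal P_{\ell,u}=\{\mathcal A:\ell\le|\mathcal A|\le u\}$. Write $x\sim y$ if $x/y\to1$. A sequential test depending on $(\alpha,\beta)$ is asymptotically optimal with respect to $\mathcal P$ if it belongs to $\Delta_{\alpha,\beta}(\mathcal P)$ for all $\alpha,\beta\in(0,1)$ and, for every $\mathcal A\in\mathcal P$, its expected sample size under $\mathsf P_{\mathcal A}$ is $\sim\inf_{(T,d)\in\Delta_{\alpha,\beta}(\mathcal P)}\mathsf E_{\mathcal A}[T]$ in the limit considered. The intersection rule $(T_I,d_I)$ with thresholds $a=|\log\beta|+\log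 K$ and $b=|\log\alpha|+\log K$ is $$T_I=\inf\{n\ge1:\lambda^k(n)\notin(-a,b)\text{ for every }k\in[K]\},\qquad d_I=\{k:\lambda^k(T_I)>0\}.$$ **Claim.** 1. For every $\mathcal A\subset[K]$, as $\alpha,\beta\to0$ (at arbitrary rates), $$\mathsf E_{\mathcal A}[T_I]\le\max\Big\{\frac{|\log\alpha|}{\eta_1^{\mathcal A}},\frac{|\log\beta|}{\eta_0^{\mathcal A}}\Big\}+O\big(K\sqrt{|\log(\alpha\wedge\beta)|}\big),$$ where the constant in $O$ depends only on a positive lower bound for the numbers $D_i^k$ and an upper bound for the second moments above; in particular it does not depend on $K$. (How small $\alpha,\beta$ have to be may depend on everything else.) 2. The intersection rule is asymptotically optimal with respect to $\mathcal P_{0,K}$, and for every $\mathcal A\subset[K]$, as $\alpha,\beta\to0$, $$\mathsf E_{\mathcal A}[T_I]\sim\max\Big\{\frac{|\log\alpha|}{\eta_1^{\mathcal A}},\frac{|\log\beta|}{\eta_0^{\mathcal A}}\Big\}\sim\inf_{(T,d)\in\Delta_{\alpha,\beta}(\mathcal P_{0,K})}\mathsf E_{\mathcal A}[T].$$ 3.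 Suppose that $D_1^k=D_0^k=D$ for every $k\in[K]$, and let $\alpha,\beta\to0$ in such a way that $|\log\alpha|\sim|\log\beta|$. Then for all $0\le\ell<u\le K$ the intersection rule is asymptotically optimal with respect to $\mathcal P_{\ell,u}$, and $$\mathsf E_{\mathcal A}[T_I]\sim\frac{|\log\alpha|}{D}\sim\inf_{(T,d)\in\Delta_{\alpha,\beta}(\mathcal P_{\ell,u})}\mathsf E_{\mathcal A}[T]\quad\text{for every }\mathcal A\in\mathcal P_{\ell,u};$$ and for all $1\le m\le K-1$, $$\mathsf E_{\mathcal A}[T_I]\sim\frac{|\log\alpha|}{D}\sim2\inf_{(T,d)\in\Delta_{\alpha,\beta}(\mathcal P_m)}\mathsf E_{\mathcal A}[T]\quad\text{for every }\mathcal A\in\mathcal P_m.$$ The last relation also holds when the infimum is restricted to the sequential tests that satisfy $|d|=m$ and $\mathsf P_{\mathcal A}(d\ne\mathcal A)\le\alpha\wedge\beta$ for every $\mathcal A\in\mathcal P_m$. -/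

import Mathlib

open MeasureTheory Filter Topology
open scoped ENNReal

universe u

noncomputable section

/-- `K` independent streams of i.i.d. observations. In stream `k` the observations have density
`f₀ k` (noise) or `f₁ k` (signal) with respect to the `σ`-finite measure `μ k`. The two laws are
mutually absolutely continuous, and both Kullback-Leibler numbers are positive and finite. -/
structure StreamModel (K : ℕ) : Type (u + 1) where
  /-- the space in which the observations of stream `k` take values -/
  E : Fin K → Type u
  [mE : ∀ k, MeasurableSpace (E k)]
  μ : ∀ k, Measure (E k)
  sigmaFinite : ∀ k, SigmaFinite (μ k)
  f₀ : ∀ k, E k → ℝ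
  f₁ : ∀ k, E k → ℝ
  measurable₀ : ∀ k, Measurable (f₀ k)
  measurable₁ : ∀ k, Measurable (f₁ k)
  nonneg₀ : ∀ k x, 0 ≤ f₀ k x
  nonneg₁ : ∀ k x, 0 ≤ f₁ k x
  density₀ : ∀ k, ∫⁻ x, ENNReal.ofReal (f₀ k x) ∂(μ k) = 1
  density₁ : ∀ k, ∫⁻ x, ENNReal.ofReal (f₁ k x) ∂(μ k) = 1
  ac₀₁ : ∀ k, (μ k).withDensity (fun x => ENNReal.ofReal (f₀ k x)) ≪
    (μ k).withDensity (fun x => ENNReal.ofReal (f₁ k x))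
  ac₁₀ : ∀ k, (μ k).withDensity (fun x => ENNReal.ofReal (f₁ k x)) ≪
    (μ k).withDensity (fun x => ENNReal.ofReal (f₀ k x))
  finite₀ : ∀ k, Integrable (fun x => Real.log (f₀ k x / f₁ k x) * f₀ k x) (μ k)
  finite₁ : ∀ k, Integrable (fun x => Real.log (f₁ k x / f₀ k x) * f₁ k x) (μ k)
  pos₀ : ∀ k, 0 < ∫ x, Real.log (f₀ k x / f₁ k x) * f₀ k x ∂(μ k)
  pos₁ : ∀ k, 0 < ∫ x, Real.log (f₁ k x / f₀ k x) * f₁ k x ∂(μ k)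

attribute [instance] StreamModel.mE

namespace StreamModel

variable {K : ℕ} (M : StreamModel.{u} K)

/-- The Kullback-Leibler number of noise against signal in stream `k`. -/
def D₀ (k : Fin K) : ℝ := ∫ x, Real.log (M.f₀ k x / M.f₁ k x) * M.f₀ k x ∂(M.μ k)

/-- The Kullback-Leibler number of signal against noise in stream `k`. -/
def D₁ (k : Fin K) : ℝ := ∫ x, Real.log (M.f₁ k x / M.f₀ k x) * M.f₁ k x ∂(M.μ k)

/-- The log-likelihood ratio of every stream has a finite second moment under both hypotheses. -/
def FiniteSecondMoment : Prop :=
  ∀ k, Integrable (fun x => Real.log (M.f₀ k x / M.f₁ k x) ^ 2 * M.f₀ k x) (M.μ k) ∧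
    Integrable (fun x => Real.log (M.f₀ k x / M.f₁ k x) ^ 2 * M.f₁ k x) (M.μ k)

/-- The second moments of the log-likelihood ratios are at most `V`. -/
def SecondMomentLE (V : ℝ) : Prop :=
  ∀ k, ∫ x, Real.log (M.f₀ k x / M.f₁ k x) ^ 2 * M.f₀ k x ∂(M.μ k) ≤ V ∧
    ∫ x, Real.log (M.f₀ k x / M.f₁ k x) ^ 2 * M.f₁ k x ∂(M.μ k) ≤ V

/-- The canonical space: `ω k j` is the observation of stream `k` at time `j + 1`. -/
abbrev Ω : Type u := ∀ k : Fin K, ℕ → M.E k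

/-- The law of one observation of stream `k` under noise. -/
def law₀ (k : Fin K) : Measure (M.E k) :=
  (M.μ k).withDensity fun x => ENNReal.ofReal (M.f₀ k x)

/-- The law of one observation of stream `k` under signal. -/
def law₁ (k : Fin K) : Measure (M.E k) :=
  (M.μ k).withDensity fun x => ENNReal.ofReal (M.f₁ k x)

open Classical in
/-- The distribution of all observations when `A` is the set of streams with signal. -/
def P (A : Finset (Fin K)) : Measure M.Ω :=
  Measure.pi fun k => Measure.infinitePi fun _ : ℕ => if k ∈ A then M.law₁ k else M.law₀ k

/-- `ℱ n` is generated by the first `n` observations of all streams. -/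
def ℱ : Filtration ℕ (inferInstance : MeasurableSpace M.Ω) where
  seq n := ⨆ (k : Fin K) (j : ℕ) (_ : j < n),
    MeasurableSpace.comap (fun ω : M.Ω => ω k j) inferInstance
  mono' _ _ h := iSup_mono fun _ => iSup_mono fun _ => iSup_mono' fun hj => ⟨hj.trans_le h, le_rfl⟩
  le' _ := iSup_le fun k => iSup_le fun j => iSup_le fun _ =>
    Measurable.comap_le (f := fun ω : M.Ω => ω k j) (by fun_prop)

/-- The cumulative log-likelihood ratio of stream `k` at time `n`. -/
def llr (k : Fin K) (n : ℕ) (ω : M.Ω) : ℝ :=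
  ∑ j ∈ Finset.range n, Real.log (M.f₁ k (ω k j) / M.f₀ k (ω k j))

/-- A sequential test `(T, d)`: a stopping time `T ∈ {1, 2, …, ∞}` and an `ℱ_T`-measurable set `d`
of streams in which signal is declared. -/
def IsSequentialTest (t : (M.Ω → WithTop ℕ) × (M.Ω → Finset (Fin K))) : Prop :=
  ∃ hT : IsStoppingTime M.ℱ t.1, (∀ ω, 1 ≤ t.1 ω) ∧
    ∀ k, MeasurableSet[hT.measurableSpace] {ω | k ∈ t.2 ω}

/-- The sequential tests with familywise type I error at most `α` and familywise type II error at
most `β` for every signal configuration in the class `C`. -/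
def Δ (α β : ℝ) (C : Set (Finset (Fin K))) :
    Set ((M.Ω → WithTop ℕ) × (M.Ω → Finset (Fin K))) :=
  {t | M.IsSequentialTest t ∧ ∀ A ∈ C,
    M.P A {ω | ∃ j, j ∉ A ∧ j ∈ t.2 ω} ≤ ENNReal.ofReal α ∧
    M.P A {ω | ∃ k, k ∈ A ∧ k ∉ t.2 ω} ≤ ENNReal.ofReal β}

/-- The expected sample size `E_A[T]`. -/
def ess (A : Finset (Fin K)) (T : M.Ω → WithTop ℕ) : ℝ≥0∞ :=
  ∫⁻ ω, ENat.toENNReal (T ω) ∂(M.P A)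

/-- The infimum of `E_A[T]` over a collection of sequential tests `(T, d)`. -/
def optimalESS (A : Finset (Fin K)) (S : Set ((M.Ω → WithTop ℕ) × (M.Ω → Finset (Fin K)))) :
    ℝ≥0∞ :=
  ⨅ t ∈ S, M.ess A t.1

/-- `η₁ = min_{k ∈ A} D₁ k`, which is `∞` if `A` is empty. -/
def η₁ (A : Finset (Fin K)) : ℝ≥0∞ := ⨅ k ∈ A, ENNReal.ofReal (M.D₁ k)

/-- `η₀ = min_{k ∉ A} D₀ k`, which is `∞` if `A` contains every stream. -/
def η₀ (A : Finset (Fin K)) : ℝ≥0∞ := ⨅ k ∉ A, ENNReal.ofReal (M.D₀ k)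

/-- The stopping time of the intersection rule with thresholds `a` and `b`: the first `n ≥ 1` at
which every log-likelihood ratio is outside `(-a, b)`. -/
def intersectionTime (a b : ℝ) : M.Ω → WithTop ℕ :=
  hittingAfter (fun n ω k => M.llr k n ω) {v : Fin K → ℝ | ∀ k, v k ∉ Set.Ioo (-a) b} 1

open Classical in
/-- The decision of the intersection rule: the streams whose log-likelihood ratio is positive upon
stopping (none, if the rule never stops). -/
def intersectionDecision (a b : ℝ) (ω : M.Ω) : Finset (Fin K) :=
  Finset.univ.filter fun k => 0 < M.llr k ((M.intersectionTime a b ω).untopD 0) ω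

/-- The intersection rule `(T_I, d_I)` with `a = |log β| + log K` and `b = |log α| + log K`. -/
def intersectionRule (α β : ℝ) : (M.Ω → WithTop ℕ) × (M.Ω → Finset (Fin K)) :=
  (M.intersectionTime (|Real.log β| + Real.log K) (|Real.log α| + Real.log K),
    M.intersectionDecision (|Real.log β| + Real.log K) (|Real.log α| + Real.log K))

/-- `max {|log α| / η₁, |log β| / η₀}`. -/
def firstOrder (A : Finset (Fin K)) (α β : ℝ) : ℝ≥0∞ :=
  max (ENNReal.ofReal |Real.log α| / M.η₁ A) (ENNReal.ofReal |Real.log β| / M.η₀ A)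

end StreamModel

/-- There are at least `ℓ` and at most `u` signals. -/
def classBetween (K ℓ u : ℕ) : Set (Finset (Fin K)) := {A | ℓ ≤ A.card ∧ A.card ≤ u}

/-- There are exactly `m` signals. -/
def classExactly (K m : ℕ) : Set (Finset (Fin K)) := {A | A.card = m}

/-- The error levels `(α, β)` tend to zero through positive values, at arbitrary rates. -/
def smallErrors : Filter (ℝ × ℝ) := 𝓝[>] 0 ×ˢ 𝓝[>] 0

/-- `x ∼ y` along `l`, i.e. `x / y → 1`. (The limit forces both to be eventually positive and
finite.) -/
def AsympEq (l : Filter (ℝ × ℝ)) (x y : ℝ × ℝ → ℝ≥0∞) : Prop :=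
  Tendsto (fun p => x p / y p) l (𝓝 1)

/-- The sequential test `R α β` has the required error control with respect to `C` for all
`α, β ∈ (0, 1)`, and along `l` it attains, to first order, the minimal expected sample size under
every signal configuration in `C`. -/
def StreamModel.IsAsymptoticallyOptimal {K : ℕ} (M : StreamModel.{u} K) (l : Filter (ℝ × ℝ))
    (C : Set (Finset (Fin K)))
    (R : ℝ → ℝ → (M.Ω → WithTop ℕ) × (M.Ω → Finset (Fin K))) : Prop :=
  (∀ α ∈ Set.Ioo (0 : ℝ) 1, ∀ β ∈ Set.Ioo (0 : ℝ) 1, R α β ∈ M.Δ α β C) ∧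
  ∀ A ∈ C, AsympEq l (fun p => M.ess A (R p.1 p.2).1)
    (fun p => M.optimalESS A (M.Δ p.1 p.2 C))

/-- The sequential tests that always declare exactly `m` signals and whose probability of a wrong
decision is at most `α ∧ β` whenever there are exactly `m` signals. -/
def StreamModel.ΔExactly {K : ℕ} (M : StreamModel.{u} K) (α β : ℝ) (m : ℕ) :
    Set ((M.Ω → WithTop ℕ) × (M.Ω → Finset (Fin K))) :=
  {t | M.IsSequentialTest t ∧ (∀ ω, (t.2 ω).card = m) ∧
    ∀ A ∈ classExactly K m, M.P A {ω | t.2 ω ≠ A} ≤ ENNReal.ofReal (min α β)}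

end

-- Every bound reduces to one of two facts about random walks stopped at a stopping time.
--
-- Lower bounds. Fix `A` and a neighbouring configuration `B`, obtained by dropping a signal `k`,
-- adding a signal `j`, or exchanging the two. A test with small errors yields an event that is
-- determined at time `T`, likely under `A` and unlikely under `B`. The log-likelihood ratio of `A`
-- against `B` must therefore be about |log α| (or |log β|) at time `T`, while by Wald's identity
-- its mean is E_A[T] times the information per step: `D₁ k`, `D₀ j`, or the sum `D₁ k + D₀ j`. This
-- is `RandomWalk.ofReal_le_lintegral_stoppingTime`. Without prior information every neighbour is
-- available, and optimizing over neighbours gives `firstOrder`. With exactly `m` signals only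
-- exchanges remain; in the symmetric case their information is 2D, which is the origin of the
-- factor 2.
--
-- Upper bounds. If finitely many walks have drifts `m i` bounded below and bounded second moments,
-- and if as long as `T` has not occurred some walk is below its threshold `c i`, then E[T] is at
-- most `H` plus a term of order √H, where `H` dominates every `c i / m i`. This is
-- `RandomWalk.lintegral_stoppingTime_le`. Fluctuations and overshoots are controlled by Wald's
-- identities for the truncated time T ∧ N, so finiteness of E[T] is never presupposed. For the
-- intersection rule the walks are the log-likelihood ratios with the sign of their drift. For known
-- `m` they are the differences between signal and noise streams, and the rule is the gap rule,
-- which stops when `m` streams lead all others by `c`.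
--
-- Error control. The event that the log-likelihood ratio of `B` against `A` is at least `b` upon
-- stopping has probability at most exp(-b) under `A` (`P_le_exp_neg`). A union bound over streams,
-- or over signal-noise pairs, explains the summand log K, or log(m(K-m)), in the thresholds.

open ProbabilityTheory

noncomputable section

-- Change of measure at random times

namespace RandomWalk

variable {Ω : Type*} {mΩ : MeasurableSpace Ω} {P Q : Measure Ω} {ℱ : Filtration ℕ mΩ}
  {T : Ω → WithTop ℕ}

/-- A change of measure along a filtration extends to random times. -/
theorem measure_eq_setLIntegral_exp_randomTime {Λ : ℕ → Ω → ℝ}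
    (hQ : ∀ n G, MeasurableSet[ℱ n] G → Q G = ∫⁻ ω in G, ENNReal.ofReal (Real.exp (Λ n ω)) ∂P)
    {τ : Ω → ℕ} {H : Set Ω} (hH : ∀ n, MeasurableSet[ℱ n] (H ∩ {ω | τ ω = n})) :
    Q H = ∫⁻ ω in H, ENNReal.ofReal (Real.exp (Λ (τ ω) ω)) ∂P := by
  have hU : H = ⋃ n, H ∩ {ω | τ ω = n} := by ext ω; simp
  have hd : Pairwise (Function.onFun Disjoint fun n => H ∩ {ω | τ ω = n}) := by
    intro m n hmn
    rw [Function.onFun, Set.disjoint_left]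
    rintro ω ⟨_, h1⟩ ⟨_, h2⟩
    exact hmn (h1.symm.trans h2)
  have hm : ∀ n, MeasurableSet (H ∩ {ω | τ ω = n}) := fun n => ℱ.le n _ (hH n)
  conv_lhs => rw [hU]
  conv_rhs => rw [hU]
  rw [measure_iUnion hd hm, lintegral_iUnion hm hd]
  refine tsum_congr fun n => ?_
  rw [hQ n _ (hH n)]
  refine setLIntegral_congr_fun (hm n) ?_
  rintro ω ⟨_, h⟩
  simp only [Set.mem_ofPred_eq] at h
  simp only [h]

/-- If the log-likelihood ratio is at least `b` on an event, the event has probability at most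
`exp (-b)`. -/
theorem measure_le_exp_neg [IsProbabilityMeasure Q] {Λ : ℕ → Ω → ℝ}
    (hQ : ∀ n G, MeasurableSet[ℱ n] G → Q G = ∫⁻ ω in G, ENNReal.ofReal (Real.exp (Λ n ω)) ∂P)
    {τ : Ω → ℕ} {H : Set Ω} (hH : ∀ n, MeasurableSet[ℱ n] (H ∩ {ω | τ ω = n})) {b : ℝ}
    (hb : ∀ ω ∈ H, b ≤ Λ (τ ω) ω) : P H ≤ ENNReal.ofReal (Real.exp (-b)) := by
  have hHm : MeasurableSet H := by
    have hU : H = ⋃ n, H ∩ {ω | τ ω = n} := by ext ω; simp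
    rw [hU]
    exact MeasurableSet.iUnion fun n => ℱ.le n _ (hH n)
  have h1 : ENNReal.ofReal (Real.exp b) * P H ≤ 1 := by
    calc ENNReal.ofReal (Real.exp b) * P H = ∫⁻ _ in H, ENNReal.ofReal (Real.exp b) ∂P := by
          rw [setLIntegral_const]
      _ ≤ ∫⁻ ω in H, ENNReal.ofReal (Real.exp (Λ (τ ω) ω)) ∂P := by
          refine setLIntegral_mono' hHm fun ω hω => ?_
          exact ENNReal.ofReal_le_ofReal (Real.exp_le_exp.2 (hb ω hω))
      _ = Q H := (measure_eq_setLIntegral_exp_randomTime hQ hH).symm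
      _ ≤ 1 := prob_le_one
  calc P H = ENNReal.ofReal (Real.exp (-b)) * (ENNReal.ofReal (Real.exp b) * P H) := by
        rw [← mul_assoc, ← ENNReal.ofReal_mul (Real.exp_nonneg _), ← Real.exp_add]
        simp
    _ ≤ ENNReal.ofReal (Real.exp (-b)) * 1 := by gcongr
    _ = _ := mul_one _

-- Truncated stopping times and their means

/-- The minimum of a random time with a deterministic one. -/
def truncTime (T : Ω → WithTop ℕ) (N : ℕ) (ω : Ω) : ℕ := (min (T ω) (N : WithTop ℕ)).untopD 0

theorem eq_top_or_natCast (x : WithTop ℕ) : x = ⊤ ∨ ∃ t : ℕ, x = (t : WithTop ℕ) := by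
  cases x with
  | top => exact Or.inl rfl
  | coe t => exact Or.inr ⟨t, rfl⟩

theorem truncTime_of_top {N : ℕ} {ω : Ω} (h : T ω = ⊤) : truncTime T N ω = N := by
  rw [truncTime, h, min_eq_right le_top]
  rfl

theorem truncTime_of_natCast {N t : ℕ} {ω : Ω} (h : T ω = t) : truncTime T N ω = min t N := by
  have hmin : min (t : WithTop ℕ) (N : WithTop ℕ) = ((min t N : ℕ) : WithTop ℕ) :=
    (WithTop.coe_min t N).symm
  rw [truncTime, h, hmin]
  rfl

theorem lt_truncTime_iff {N j : ℕ} {ω : Ω} :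
    j < truncTime T N ω ↔ j < N ∧ (j : WithTop ℕ) < T ω := by
  obtain h | ⟨t, h⟩ := eq_top_or_natCast (T ω)
  · simp [truncTime_of_top h, h]
  · rw [truncTime_of_natCast h, h, Nat.cast_lt, lt_min_iff, and_comm]

theorem truncTime_eq_iff_of_lt {N n : ℕ} {ω : Ω} (h : n < N) :
    truncTime T N ω = n ↔ T ω = n := by
  obtain hT | ⟨t, hT⟩ := eq_top_or_natCast (T ω)
  · simp [truncTime_of_top hT, hT, h.ne']
  · rw [truncTime_of_natCast hT, hT, Nat.cast_inj]
    omega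

theorem truncTime_le (N : ℕ) (ω : Ω) : truncTime T N ω ≤ N := by
  by_contra h
  exact lt_irrefl _ (lt_truncTime_iff.1 (not_le.1 h)).1

theorem truncTime_self_eq_iff {N : ℕ} {ω : Ω} :
    truncTime T N ω = N ↔ (N : WithTop ℕ) ≤ T ω := by
  obtain hT | ⟨t, hT⟩ := eq_top_or_natCast (T ω)
  · simp [truncTime_of_top hT, hT]
  · rw [truncTime_of_natCast hT, hT, Nat.cast_le]
    omega

/-- Basis of both Wald identities: the range becomes deterministic, and for a stopping time the
weight of `Y j` is the indicator of an event in `ℱ j`, which does not look at the increment `Y j`.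
-/
theorem sum_range_truncTime (Y : ℕ → Ω → ℝ) (N : ℕ) (ω : Ω) :
    ∑ j ∈ Finset.range (truncTime T N ω), Y j ω =
      ∑ j ∈ Finset.range N, {ω | (j : WithTop ℕ) < T ω}.indicator (Y j) ω := by
  classical
  simp only [Set.indicator_apply, Set.mem_ofPred_eq]
  rw [← Finset.sum_filter]
  refine Finset.sum_congr ?_ fun _ _ => rfl
  ext j
  simp [lt_truncTime_iff]

theorem measurableSet_lt_stoppingTime (hT : IsStoppingTime ℱ T) (j : ℕ) :
    MeasurableSet[ℱ j] {ω | (j : WithTop ℕ) < T ω} := hT.measurableSet_gt j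

/-- The expectation of the truncated time. -/
def truncMean (P : Measure Ω) (T : Ω → WithTop ℕ) (N : ℕ) : ℝ :=
  ∑ j ∈ Finset.range N, P.real {ω | (j : WithTop ℕ) < T ω}

theorem truncTime_eq_sum (N : ℕ) (ω : Ω) : (truncTime T N ω : ℝ) =
    ∑ j ∈ Finset.range N, {ω | (j : WithTop ℕ) < T ω}.indicator (fun _ => (1 : ℝ)) ω := by
  rw [← sum_range_truncTime (fun _ _ => (1 : ℝ))]
  simp

theorem integral_truncTime [IsFiniteMeasure P] (hT : IsStoppingTime ℱ T) (N : ℕ) :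
    ∫ ω, (truncTime T N ω : ℝ) ∂P = truncMean P T N := by
  simp only [truncTime_eq_sum]
  have hm : ∀ j : ℕ, MeasurableSet {ω | (j : WithTop ℕ) < T ω} :=
    fun j => ℱ.le j _ (measurableSet_lt_stoppingTime hT j)
  rw [integral_finsetSum _ fun j _ => (integrable_const _).indicator (hm j)]
  refine Finset.sum_congr rfl fun j _ => ?_
  rw [integral_indicator (hm j)]
  simp

theorem integrable_truncTime [IsFiniteMeasure P] (hT : IsStoppingTime ℱ T) (N : ℕ) :
    Integrable (fun ω => (truncTime T N ω : ℝ)) P := by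
  simp only [truncTime_eq_sum]
  exact integrable_finsetSum _ fun j _ =>
    (integrable_const _).indicator (ℱ.le j _ (measurableSet_lt_stoppingTime hT j))

theorem lintegral_toENNReal_eq_tsum (hT : IsStoppingTime ℱ T) :
    ∫⁻ ω, ENat.toENNReal (T ω) ∂P = ∑' j : ℕ, P {ω | (j : WithTop ℕ) < T ω} := by
  have hm : ∀ j : ℕ, MeasurableSet {ω | (j : WithTop ℕ) < T ω} :=
    fun j => ℱ.le j _ (measurableSet_lt_stoppingTime hT j)
  have h : ∀ ω, ENat.toENNReal (T ω) =
      ∑' j : ℕ, {ω | (j : WithTop ℕ) < T ω}.indicator (fun _ => (1 : ℝ≥0∞)) ω := by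
    intro ω
    obtain hω | ⟨t, hω⟩ := eq_top_or_natCast (T ω)
    · simp only [Set.indicator_apply, Set.mem_ofPred_eq, hω, WithTop.natCast_lt_top, if_true]
      rw [ENNReal.tsum_const_eq_top_of_ne_zero one_ne_zero]
      exact ENat.toENNReal_top
    · rw [hω, tsum_eq_sum (s := Finset.range t)]
      · rw [Finset.sum_congr rfl (g := fun _ => (1 : ℝ≥0∞))]
        · simp only [Finset.sum_const, Finset.card_range, nsmul_eq_mul, mul_one]
          exact ENat.toENNReal_coe t
        · intro j hj
          rw [Set.indicator_of_mem]
          simp only [Set.mem_ofPred_eq, hω, Nat.cast_lt]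
          exact Finset.mem_range.1 hj
      · intro j hj
        rw [Set.indicator_of_notMem]
        simp only [Set.mem_ofPred_eq, hω, Nat.cast_lt]
        exact fun h => hj (Finset.mem_range.2 h)
  simp only [h]
  rw [lintegral_tsum fun j => (measurable_const.indicator (hm j)).aemeasurable]
  exact tsum_congr fun j => lintegral_indicator_one (hm j)

theorem ofReal_truncMean [IsFiniteMeasure P] (N : ℕ) :
    ENNReal.ofReal (truncMean P T N) = ∑ j ∈ Finset.range N, P {ω | (j : WithTop ℕ) < T ω} := by
  rw [truncMean, ENNReal.ofReal_sum_of_nonneg fun _ _ => measureReal_nonneg]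
  exact Finset.sum_congr rfl fun j _ => ofReal_measureReal

theorem ofReal_truncMean_le [IsFiniteMeasure P] (hT : IsStoppingTime ℱ T) (N : ℕ) :
    ENNReal.ofReal (truncMean P T N) ≤ ∫⁻ ω, ENat.toENNReal (T ω) ∂P := by
  rw [ofReal_truncMean, lintegral_toENNReal_eq_tsum hT]
  exact ENNReal.sum_le_tsum _

/-- Bounds uniform in `N` pass to the limit through the tail-sum formula, so estimates may be made
for the bounded time T ∧ N alone. -/
theorem lintegral_le_of_truncMean_le [IsFiniteMeasure P] (hT : IsStoppingTime ℱ T) {B : ℝ}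
    (h : ∀ N, 1 ≤ N → truncMean P T N ≤ B) :
    ∫⁻ ω, ENat.toENNReal (T ω) ∂P ≤ ENNReal.ofReal B := by
  rw [lintegral_toENNReal_eq_tsum hT]
  refine le_of_tendsto (ENNReal.summable.hasSum.tendsto_sum_nat) ?_
  filter_upwards [eventually_ge_atTop 1] with N hN
  rw [← ofReal_truncMean]
  exact ENNReal.ofReal_le_ofReal (h N hN)

theorem integrable_sum_truncTime (hT : IsStoppingTime ℱ T) {Y : ℕ → Ω → ℝ}
    (hY : ∀ j, Integrable (Y j) P) (N : ℕ) :
    Integrable (fun ω => ∑ j ∈ Finset.range (truncTime T N ω), Y j ω) P := by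
  simp only [sum_range_truncTime]
  exact integrable_finsetSum _ fun j _ =>
    (hY j).indicator (ℱ.le j _ (measurableSet_lt_stoppingTime hT j))

-- Wald's identities

theorem integral_mul_of_indep [IsProbabilityMeasure P] {j : ℕ} {g Y : Ω → ℝ}
    (hg : Measurable[ℱ j] g) (hY : Measurable Y)
    (hind : Indep (ℱ j) (MeasurableSpace.comap Y inferInstance) P) :
    ∫ ω, g ω * Y ω ∂P = (∫ ω, g ω ∂P) * ∫ ω, Y ω ∂P := by
  refine IndepFun.integral_fun_mul_eq_mul_integral ?_
    (hg.mono (ℱ.le j) le_rfl).aestronglyMeasurable hY.aestronglyMeasurable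
  rw [IndepFun_iff_Indep]
  exact indep_of_indep_of_le_left hind hg.comap_le

theorem integral_indicator_lt [IsProbabilityMeasure P] (hT : IsStoppingTime ℱ T) {Y : Ω → ℝ}
    {j : ℕ} (hY : Measurable Y) (hind : Indep (ℱ j) (MeasurableSpace.comap Y inferInstance) P) :
    ∫ ω, {ω | (j : WithTop ℕ) < T ω}.indicator Y ω ∂P =
      P.real {ω | (j : WithTop ℕ) < T ω} * ∫ ω, Y ω ∂P := by
  have hs := measurableSet_lt_stoppingTime hT j
  have hg : Measurable[ℱ j] ({ω | (j : WithTop ℕ) < T ω}.indicator (fun _ => (1 : ℝ))) :=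
    Measurable.indicator measurable_const hs
  have h := integral_mul_of_indep hg hY hind
  rw [integral_indicator (ℱ.le j _ hs)] at h
  simp only [integral_const, measureReal_restrict_apply_univ, smul_eq_mul, mul_one] at h
  rw [← h]
  congr 1
  ext ω
  simp [Set.indicator_apply]

/-- Wald's identity for truncated stopping times. -/
theorem integral_sum_truncTime [IsProbabilityMeasure P] (hT : IsStoppingTime ℱ T)
    {Y : ℕ → Ω → ℝ} (hm : ∀ j, Measurable (Y j)) (hY : ∀ j, Integrable (Y j) P)
    (hind : ∀ j, Indep (ℱ j) (MeasurableSpace.comap (Y j) inferInstance) P) (N : ℕ) :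
    ∫ ω, ∑ j ∈ Finset.range (truncTime T N ω), Y j ω ∂P =
      ∑ j ∈ Finset.range N, P.real {ω | (j : WithTop ℕ) < T ω} * ∫ ω, Y j ω ∂P := by
  simp only [sum_range_truncTime]
  rw [integral_finsetSum _ fun j _ =>
    (hY j).indicator (ℱ.le j _ (measurableSet_lt_stoppingTime hT j))]
  exact Finset.sum_congr rfl fun j _ => integral_indicator_lt hT (hm j) (hind j)

theorem memLp_sum_truncTime (hT : IsStoppingTime ℱ T) {Y : ℕ → Ω → ℝ}
    (hY : ∀ j, MemLp (Y j) 2 P) (N : ℕ) :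
    MemLp (fun ω => ∑ j ∈ Finset.range (truncTime T N ω), Y j ω) 2 P := by
  simp only [sum_range_truncTime]
  exact memLp_finsetSum _ fun j _ =>
    (hY j).indicator (ℱ.le j _ (measurableSet_lt_stoppingTime hT j))

/-- Wald's second identity, as an inequality for truncated stopping times. -/
theorem integral_sq_sum_truncTime_le [IsProbabilityMeasure P] (hT : IsStoppingTime ℱ T)
    {Y : ℕ → Ω → ℝ} (hadapt : ∀ j, Measurable[ℱ (j + 1)] (Y j)) (hY : ∀ j, MemLp (Y j) 2 P)
    (hind : ∀ j, Indep (ℱ j) (MeasurableSpace.comap (Y j) inferInstance) P)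
    (hmean : ∀ j, ∫ ω, Y j ω ∂P = 0) {V : ℝ} (hsq : ∀ j, ∫ ω, Y j ω ^ 2 ∂P ≤ V) (N : ℕ) :
    ∫ ω, (∑ j ∈ Finset.range (truncTime T N ω), Y j ω) ^ 2 ∂P ≤ V * truncMean P T N := by
  have hm : ∀ j, Measurable (Y j) := fun j => (hadapt j).mono (ℱ.le _) le_rfl
  induction N with
  | zero => simp [truncMean, sum_range_truncTime]
  | succ N ih =>
    set X : Ω → ℝ := fun ω => ∑ j ∈ Finset.range (truncTime T N ω), Y j ω with hX
    set s : Set Ω := {ω | (N : WithTop ℕ) < T ω} with hs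
    have hsN : MeasurableSet[ℱ N] s := measurableSet_lt_stoppingTime hT N
    have hXL : MemLp X 2 P := memLp_sum_truncTime hT hY N
    have hXm : Measurable[ℱ N] X := by
      have : X = fun ω => ∑ j ∈ Finset.range N,
          {ω | (j : WithTop ℕ) < T ω}.indicator (Y j) ω := by
        funext ω; exact sum_range_truncTime _ _ _
      rw [this]
      refine Finset.measurable_fun_sum _ fun j hj => ?_
      have hjN : j < N := Finset.mem_range.1 hj
      exact ((hadapt j).mono (ℱ.mono hjN) le_rfl).indicator
        (ℱ.mono hjN.le _ (measurableSet_lt_stoppingTime hT j))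
    have hstep : ∀ ω, (∑ j ∈ Finset.range (truncTime T (N + 1) ω), Y j ω) ^ 2 =
        X ω ^ 2 + 2 * (s.indicator X ω * Y N ω) + s.indicator (fun ω => Y N ω ^ 2) ω := by
      intro ω
      rw [sum_range_truncTime, Finset.sum_range_succ, ← sum_range_truncTime]
      by_cases h : ω ∈ s
      · rw [Set.indicator_of_mem h, Set.indicator_of_mem h, Set.indicator_of_mem h]
        ring
      · rw [Set.indicator_of_notMem h, Set.indicator_of_notMem h, Set.indicator_of_notMem h]
        ring
    -- Orthogonality of martingale increments: the stopped sum on {T > N} is `ℱ N`-measurable, and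
    -- `Y N` is centred and independent of `ℱ N`.
    have hcross : ∫ ω, s.indicator X ω * Y N ω ∂P = 0 := by
      rw [integral_mul_of_indep (hXm.indicator hsN) (hm N) (hind N), hmean, mul_zero]
    have hi1 : Integrable (fun ω => X ω ^ 2) P := hXL.integrable_sq
    have hi2 : Integrable (fun ω => s.indicator X ω * Y N ω) P :=
      (hXL.indicator (ℱ.le N _ hsN)).integrable_mul (hY N)
    have hi3 : Integrable (s.indicator fun ω => Y N ω ^ 2) P :=
      (hY N).integrable_sq.indicator (ℱ.le N _ hsN)
    have hind2 : Indep (ℱ N) (MeasurableSpace.comap (fun ω => Y N ω ^ 2) inferInstance) P := by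
      refine indep_of_indep_of_le_right (hind N) ?_
      exact ((measurable_id.pow_const 2).comp (comap_measurable (Y N))).comap_le
    have h3 : ∫ ω, s.indicator (fun ω => Y N ω ^ 2) ω ∂P ≤ P.real s * V := by
      rw [hs, integral_indicator_lt hT ((hm N).pow_const 2) hind2]
      exact mul_le_mul_of_nonneg_left (hsq N) measureReal_nonneg
    simp only [hstep]
    have hi4 : Integrable (fun ω => 2 * (s.indicator X ω * Y N ω)) P := hi2.const_mul 2
    have hi5 : Integrable (fun ω => X ω ^ 2 + 2 * (s.indicator X ω * Y N ω)) P := hi1.add hi4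
    rw [integral_add hi5 hi3, integral_add hi1 hi4, integral_const_mul, hcross, truncMean,
      Finset.sum_range_succ, ← truncMean]
    linarith

-- Upper bound for the expected stopping time

/-- Overshoot control. If T has occurred by time `N`, some walk was below its threshold one step
earlier, and its last increment is at most the root of the sum of all squared increments. Unlike the
single last increment, that sum has a mean given by Wald's identity. -/
theorem exists_sum_truncTime_le {ι : Type*} [Nonempty ι] {Y : ι → ℕ → Ω → ℝ} {c : ι → ℝ}
    (hc : ∀ i, 0 < c i) {ω : Ω} (hT1 : 1 ≤ T ω)
    (hbelow : ∀ n : ℕ, 1 ≤ n → (n : WithTop ℕ) < T ω →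
      ∃ i, ∑ j ∈ Finset.range n, Y i j ω < c i) {N : ℕ} (hN : 1 ≤ N) :
    ∃ i, ∑ j ∈ Finset.range (truncTime T N ω), Y i j ω ≤
      c i + √(∑ j ∈ Finset.range (truncTime T N ω), Y i j ω ^ 2) := by
  set t := truncTime T N ω with ht
  have ht1 : 0 < t := lt_truncTime_iff.2 ⟨hN, lt_of_lt_of_le (by norm_num) hT1⟩
  by_cases hNT : (N : WithTop ℕ) < T ω
  · have htN : t = N := truncTime_self_eq_iff.2 hNT.le
    obtain ⟨i, hi⟩ := hbelow N hN hNT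
    refine ⟨i, ?_⟩
    rw [htN]
    have := Real.sqrt_nonneg (∑ j ∈ Finset.range N, Y i j ω ^ 2)
    linarith
  · obtain ⟨r, hr⟩ : ∃ r, t = r + 1 := ⟨t - 1, by omega⟩
    have hrT : (r : WithTop ℕ) < T ω := (lt_truncTime_iff.1 (show r < t by omega)).2
    obtain ⟨i, hi⟩ : ∃ i, ∑ j ∈ Finset.range r, Y i j ω < c i := by
      -- `hbelow` starts at n = 1; at r = 0 the sum is empty, and any positive threshold exceeds it.
      rcases Nat.eq_zero_or_pos r with h0 | h0
      · obtain ⟨i⟩ := ‹Nonempty ι›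
        exact ⟨i, by simpa [h0] using hc i⟩
      · exact hbelow r h0 hrT
    refine ⟨i, ?_⟩
    rw [hr, Finset.sum_range_succ]
    have hle : Y i r ω ≤ √(∑ j ∈ Finset.range (r + 1), Y i j ω ^ 2) := by
      refine Real.le_sqrt_of_sq_le ?_
      exact Finset.single_le_sum (f := fun j => Y i j ω ^ 2) (fun _ _ => sq_nonneg _)
        (Finset.self_mem_range_succ r)
    linarith

/-- Arithmetic-geometric mean, used in place of the Cauchy-Schwarz inequality: the right side is
linear in `x ^ 2`, whose mean is known. -/
theorem abs_le_half_add_sq_div {x s : ℝ} (hs : 0 < s) : |x| ≤ (s + x ^ 2 / s) / 2 := by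
  have h : |x| * s ≤ (s + x ^ 2 / s) / 2 * s := by
    have : (s + x ^ 2 / s) / 2 * s = (s ^ 2 + x ^ 2) / 2 := by field_simp
    rw [this, ← sq_abs x]
    nlinarith [sq_nonneg (|x| - s)]
  exact le_of_mul_le_mul_right h hs

/-- Solves the self-bounding inequality satisfied by the truncated mean: first √e ≤ √H + C, then
this is put back into the hypothesis. -/
theorem le_of_le_add_mul_sqrt {e H C : ℝ} (he : 0 ≤ e) (hH : 0 ≤ H) (hC : 0 ≤ C)
    (h : e ≤ H + C * √e) : e ≤ H + C * √H + C ^ 2 := by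
  have h1 : √e ≤ √H + C := by
    by_contra hlt
    push Not at hlt
    have e1 := Real.mul_self_sqrt he
    have e2 := Real.mul_self_sqrt hH
    nlinarith [Real.sqrt_nonneg e, Real.sqrt_nonneg H]
  nlinarith

/-- The expected time at which finitely many random walks with positive drifts are simultaneously
above their thresholds. -/
theorem lintegral_stoppingTime_le {ι : Type*} [Fintype ι] [Nonempty ι] [IsProbabilityMeasure P]
    (hT : IsStoppingTime ℱ T) (hT1 : ∀ ω, 1 ≤ T ω) {Y : ι → ℕ → Ω → ℝ}
    (hadapt : ∀ i j, Measurable[ℱ (j + 1)] (Y i j)) (hY : ∀ i j, MemLp (Y i j) 2 P)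
    (hind : ∀ i j, Indep (ℱ j) (MeasurableSpace.comap (Y i j) inferInstance) P)
    {m c : ι → ℝ} (hmean : ∀ i j, ∫ ω, Y i j ω ∂P = m i) {V δ H : ℝ} (hV : 0 < V)
    (hsq : ∀ i j, ∫ ω, Y i j ω ^ 2 ∂P ≤ V) (hδ : 0 < δ) (hm : ∀ i, δ ≤ m i)
    (hc : ∀ i, 0 < c i) (hcH : ∀ i, c i ≤ H * m i)
    (hbelow : ∀ ω (n : ℕ), 1 ≤ n → (n : WithTop ℕ) < T ω →
      ∃ i, ∑ j ∈ Finset.range n, Y i j ω < c i) :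
    ∫⁻ ω, ENat.toENNReal (T ω) ∂P ≤
      ENNReal.ofReal (H + (Fintype.card ι * (2 * √V / δ)) * √H +
        (Fintype.card ι * (2 * √V / δ)) ^ 2) := by
  have hYm : ∀ i j, Measurable (Y i j) := fun i j => (hadapt i j).mono (ℱ.le _) le_rfl
  have hH : 0 ≤ H := by
    obtain ⟨i⟩ := ‹Nonempty ι›
    by_contra hneg
    nlinarith [hc i, hcH i, hm i]
  refine lintegral_le_of_truncMean_le hT fun N hN => ?_
  set e := truncMean P T N with he
  have he1 : 1 ≤ e := by
    have h0 : P.real {ω | ((0 : ℕ) : WithTop ℕ) < T ω} = 1 := by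
      have : {ω | ((0 : ℕ) : WithTop ℕ) < T ω} = Set.univ := by
        ext ω
        simpa using lt_of_lt_of_le (by norm_num) (hT1 ω)
      rw [this, probReal_univ]
    rw [he, truncMean, ← h0]
    exact Finset.single_le_sum (f := fun j : ℕ => P.real {ω | (j : WithTop ℕ) < T ω})
      (fun _ _ => measureReal_nonneg) (Finset.mem_range.2 hN)
  -- The root-mean-square size of the fluctuations up to the truncated time. It balances the two
  -- terms of `abs_le_half_add_sq_div`, and is positive because T ≥ 1 forces e ≥ 1.
  set s := √(V * e) with hs
  have hs0 : 0 < s := Real.sqrt_pos.2 (by positivity)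
  set X : ι → Ω → ℝ := fun i ω => ∑ j ∈ Finset.range (truncTime T N ω), (Y i j ω - m i) with hX
  set R : ι → Ω → ℝ := fun i ω => ∑ j ∈ Finset.range (truncTime T N ω), Y i j ω ^ 2 with hR
  have hR0 : ∀ i ω, 0 ≤ R i ω := fun i ω => Finset.sum_nonneg fun _ _ => sq_nonneg _
  have hcL : ∀ i j, MemLp (fun ω => Y i j ω - m i) 2 P :=
    fun i j => (hY i j).sub (memLp_const _)
  have hXi : ∀ i, Integrable (fun ω => X i ω ^ 2) P := fun i =>
    (memLp_sum_truncTime hT (hcL i) N).integrable_sq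
  have hRi : ∀ i, Integrable (R i) P := fun i =>
    integrable_sum_truncTime hT (fun j => (hY i j).integrable_sq) N
  have hY1 : ∀ i j, Integrable (Y i j) P := fun i j => (hY i j).integrable (by norm_num)
  have hXV : ∀ i, ∫ ω, X i ω ^ 2 ∂P ≤ V * e := by
    intro i
    refine integral_sq_sum_truncTime_le hT (fun j => (hadapt i j).sub_const _) (hcL i)
      (fun j => ?_) (fun j => ?_) (fun j => ?_) N
    · refine indep_of_indep_of_le_right (hind i j) ?_
      exact ((measurable_id.sub_const (m i)).comp (comap_measurable (Y i j))).comap_le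
    · rw [integral_sub (hY1 i j) (integrable_const _), hmean]
      simp
    · have hexp : ∀ ω, (Y i j ω - m i) ^ 2 = Y i j ω ^ 2 - 2 * m i * Y i j ω + m i ^ 2 :=
        fun ω => by ring
      simp only [hexp]
      have hi : Integrable (fun ω => 2 * m i * Y i j ω) P := (hY1 i j).const_mul _
      have hi' : Integrable (fun ω => Y i j ω ^ 2 - 2 * m i * Y i j ω) P :=
        (hY i j).integrable_sq.sub hi
      rw [integral_add hi' (integrable_const _), integral_sub (hY i j).integrable_sq hi,
        integral_const_mul, hmean]
      simp only [integral_const, probReal_univ, smul_eq_mul, one_mul]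
      nlinarith [hsq i j, sq_nonneg (m i)]
  have hRV : ∀ i, ∫ ω, R i ω ∂P ≤ V * e := by
    intro i
    have hind2 : ∀ j, Indep (ℱ j) (MeasurableSpace.comap (fun ω => Y i j ω ^ 2) inferInstance) P :=
      fun j => indep_of_indep_of_le_right (hind i j)
        ((measurable_id.pow_const 2).comp (comap_measurable (Y i j))).comap_le
    rw [hR, integral_sum_truncTime hT (fun j => (hYm i j).pow_const 2)
      (fun j => (hY i j).integrable_sq) hind2, he, truncMean, Finset.mul_sum]
    refine Finset.sum_le_sum fun j _ => ?_
    rw [mul_comm]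
    exact mul_le_mul_of_nonneg_right (hsq i j) measureReal_nonneg
  -- The walk that is late depends on ω. Summing over all walks removes this dependence at the price
  -- of the factor `Fintype.card ι`, the source of the factor K in the remainder.
  have hpt : ∀ ω, (truncTime T N ω : ℝ) ≤
      H + ∑ i, ((s + X i ω ^ 2 / s) / 2 + (s + R i ω / s) / 2) / δ := by
    intro ω
    obtain ⟨i, hi⟩ := exists_sum_truncTime_le hc (hT1 ω) (hbelow ω) hN
    have hXsum : X i ω = ∑ j ∈ Finset.range (truncTime T N ω), Y i j ω -
        m i * truncTime T N ω := by
      rw [hX]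
      simp [mul_comm]
    have h1 := abs_le_half_add_sq_div (x := X i ω) hs0
    have h2 := abs_le_half_add_sq_div (x := √(R i ω)) hs0
    rw [Real.sq_sqrt (hR0 i ω)] at h2
    have h3 : (truncTime T N ω : ℝ) ≤ H + (|X i ω| + |√(R i ω)|) / δ := by
      have h4 : ((truncTime T N ω : ℝ) - H) * m i ≤ |X i ω| + |√(R i ω)| := by
        have h5 := neg_abs_le (X i ω)
        have h6 := le_abs_self (√(R i ω))
        have h7 := hcH i
        nlinarith [hi]
      by_cases hpos : (truncTime T N ω : ℝ) ≤ H
      · have : 0 ≤ (|X i ω| + |√(R i ω)|) / δ := by positivity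
        linarith
      · rw [← sub_le_iff_le_add', le_div_iff₀ hδ]
        refine le_trans ?_ h4
        exact mul_le_mul_of_nonneg_left (hm i) (by linarith)
    refine h3.trans (add_le_add le_rfl ?_)
    refine le_trans ?_ (Finset.single_le_sum
      (f := fun i => ((s + X i ω ^ 2 / s) / 2 + (s + R i ω / s) / 2) / δ) (fun i _ => ?_)
      (Finset.mem_univ i))
    · gcongr
    · have := hR0 i ω
      positivity
  have hXs : ∀ i, Integrable (fun ω => (s + X i ω ^ 2 / s) / 2) P := fun i =>
    ((integrable_const s).add ((hXi i).div_const s)).div_const 2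
  have hRs : ∀ i, Integrable (fun ω => (s + R i ω / s) / 2) P := fun i =>
    ((integrable_const s).add ((hRi i).div_const s)).div_const 2
  have hint : ∀ i, Integrable
      (fun ω => ((s + X i ω ^ 2 / s) / 2 + (s + R i ω / s) / 2) / δ) P := fun i =>
    ((hXs i).add (hRs i)).div_const δ
  have hmono : e ≤ ∫ ω, (H + ∑ i, ((s + X i ω ^ 2 / s) / 2 + (s + R i ω / s) / 2) / δ) ∂P := by
    rw [he, ← integral_truncTime hT]
    exact integral_mono (integrable_truncTime hT N)
      ((integrable_const H).add (integrable_finsetSum _ fun i _ => hint i)) hpt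
  have hVs : V * e / s = s := by
    rw [div_eq_iff hs0.ne', hs, Real.mul_self_sqrt (by positivity)]
  have hterm : ∀ i, ∫ ω, ((s + X i ω ^ 2 / s) / 2 + (s + R i ω / s) / 2) / δ ∂P ≤ 2 * s / δ := by
    intro i
    rw [integral_div, integral_add (hXs i) (hRs i), integral_div, integral_div,
      integral_add (integrable_const s) ((hXi i).div_const s),
      integral_add (integrable_const s) ((hRi i).div_const s), integral_div, integral_div]
    simp only [integral_const, probReal_univ, smul_eq_mul, one_mul]
    have h1 : (∫ ω, X i ω ^ 2 ∂P) / s ≤ s :=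
      (div_le_div_of_nonneg_right (hXV i) hs0.le).trans hVs.le
    have h2 : (∫ ω, R i ω ∂P) / s ≤ s :=
      (div_le_div_of_nonneg_right (hRV i) hs0.le).trans hVs.le
    exact div_le_div_of_nonneg_right (by linarith) hδ.le
  have hfinal : e ≤ H + Fintype.card ι * (2 * √V / δ) * √e := by
    refine hmono.trans ?_
    rw [integral_add (integrable_const H) (integrable_finsetSum _ fun i _ => hint i),
      integral_finsetSum _ fun i _ => hint i]
    simp only [integral_const, probReal_univ, smul_eq_mul, one_mul]
    refine add_le_add le_rfl ((Finset.sum_le_sum fun i _ => hterm i).trans (le_of_eq ?_))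
    rw [Finset.sum_const, Finset.card_univ, nsmul_eq_mul, hs, Real.sqrt_mul hV.le]
    ring
  exact le_of_le_add_mul_sqrt (by linarith) hH (by positivity) hfinal

theorem measure_eq_top_eq_zero (hT : IsStoppingTime ℱ T)
    (h : ∫⁻ ω, ENat.toENNReal (T ω) ∂P ≠ ⊤) : P {ω | T ω = ⊤} = 0 := by
  rw [lintegral_toENNReal_eq_tsum hT] at h
  refine le_antisymm (ge_of_tendsto (ENNReal.tendsto_atTop_zero_of_tsum_ne_top h) ?_) zero_le
  refine Eventually.of_forall fun j => measure_mono fun ω (hω : T ω = ⊤) => ?_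
  simp [hω]

-- Lower bound for the expected stopping time

/-- The stopped change of measure on events determined at the truncated time. -/
theorem measure_eq_setLIntegral_exp_truncTime {Λ : ℕ → Ω → ℝ}
    (hQ : ∀ n G, MeasurableSet[ℱ n] G → Q G = ∫⁻ ω in G, ENNReal.ofReal (Real.exp (Λ n ω)) ∂P)
    {N : ℕ} {H : Set Ω} (hH : ∀ n : ℕ, n < N → MeasurableSet[ℱ n] (H ∩ {ω | T ω = n}))
    (hHN : MeasurableSet[ℱ N] (H ∩ {ω | (N : WithTop ℕ) ≤ T ω})) :
    Q H = ∫⁻ ω in H, ENNReal.ofReal (Real.exp (Λ (truncTime T N ω) ω)) ∂P := by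
  refine measure_eq_setLIntegral_exp_randomTime hQ (τ := truncTime T N) fun n => ?_
  rcases lt_trichotomy n N with h | h | h
  · simpa only [truncTime_eq_iff_of_lt h] using hH n h
  · subst h
    simpa only [truncTime_self_eq_iff] using hHN
  · have : H ∩ {ω | truncTime T N ω = n} = ∅ := by
      ext ω
      have := truncTime_le (T := T) N ω
      simp only [Set.mem_inter_iff, Set.mem_ofPred_eq, Set.mem_empty_iff_false, iff_false, not_and]
      omega
    rw [this]
    exact @MeasurableSet.empty _ (ℱ n)

/-- Lower bound for the expected sample size of a test of `P` against `Q`: `G` is an event,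
determined at time `T`, that is likely under `P` and unlikely under `Q`, and `Z` are the increments
of the log-likelihood ratio of `P` against `Q`. -/
theorem ofReal_le_lintegral_stoppingTime [IsProbabilityMeasure P] [IsProbabilityMeasure Q]
    (hT : IsStoppingTime ℱ T) {Z : ℕ → Ω → ℝ} (hadapt : ∀ j, Measurable[ℱ (j + 1)] (Z j))
    (hZ : ∀ j, Integrable (Z j) P)
    (hind : ∀ j, Indep (ℱ j) (MeasurableSpace.comap (Z j) inferInstance) P)
    {I : ℝ} (hI : 0 < I) (hmean : ∀ j, ∫ ω, Z j ω ∂P = I)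
    (hQ : ∀ n G, MeasurableSet[ℱ n] G →
      Q G = ∫⁻ ω in G, ENNReal.ofReal (Real.exp (-∑ j ∈ Finset.range n, Z j ω)) ∂P)
    {G : Set Ω} (hG : MeasurableSet[hT.measurableSpace] G) {ε α : ℝ} (hα : 0 < α) (hα1 : α < 1)
    (hε : 0 ≤ ε) (hGP : P Gᶜ ≤ ENNReal.ofReal ε) (hGQ : Q G ≤ ENNReal.ofReal α) :
    ENNReal.ofReal (((1 - ε) * |Real.log α| - 1) / I) ≤ ∫⁻ ω, ENat.toENNReal (T ω) ∂P := by
  have hGm : MeasurableSet G := hT.measurableSpace_le _ hG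
  have hZm : ∀ j, Measurable (Z j) := fun j => (hadapt j).mono (ℱ.le _) le_rfl
  by_cases htop : ∫⁻ ω, ENat.toENNReal (T ω) ∂P = ⊤
  · rw [htop]; exact le_top
  set L := |Real.log α| with hL
  have hLpos : 0 ≤ L := abs_nonneg _
  have hexpL : Real.exp L * α = 1 := by
    rw [hL, abs_of_neg (Real.log_neg hα hα1), Real.exp_neg, Real.exp_log hα,
      inv_mul_cancel₀ hα.ne']
  set E := (∫⁻ ω, ENat.toENNReal (T ω) ∂P).toReal with hE
  -- Truncation makes all integrals finite. `G` is cut down to {T ≤ N} because only this part of it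
  -- is known to be determined by time `N`.
  have hmain : ∀ N : ℕ, L * P.real (G ∩ {ω | T ω ≤ N}) - 1 ≤ I * E := by
    intro N
    set W : Ω → ℝ := fun ω => ∑ j ∈ Finset.range (truncTime T N ω), Z j ω with hW
    set GN := G ∩ {ω | T ω ≤ N} with hGN
    have hGNm : MeasurableSet GN := ℱ.le N _ (hG.2 N)
    have hGn : ∀ n : ℕ, MeasurableSet[ℱ n] (G ∩ {ω | T ω = n}) := by
      intro n
      have : G ∩ {ω | T ω = n} = (G ∩ {ω | T ω ≤ n}) ∩ {ω | T ω = n} := by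
        ext ω
        simp only [Set.mem_inter_iff, Set.mem_ofPred_eq]
        exact ⟨fun h => ⟨⟨h.1, h.2.le⟩, h.2⟩, fun h => ⟨h.1.1, h.2⟩⟩
      rw [this]
      exact (hG.2 n).inter (hT.measurableSet_eq n)
    have hQGN : Q GN = ∫⁻ ω in GN, ENNReal.ofReal (Real.exp (-W ω)) ∂P := by
      refine measure_eq_setLIntegral_exp_truncTime (T := T) hQ (fun n hn => ?_) ?_
      · have : GN ∩ {ω | T ω = n} = G ∩ {ω | T ω = n} := by
          ext ω
          simp only [hGN, Set.mem_inter_iff, Set.mem_ofPred_eq]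
          refine ⟨fun h => ⟨h.1.1, h.2⟩, fun h => ⟨⟨h.1, ?_⟩, h.2⟩⟩
          rw [h.2, Nat.cast_le]
          exact hn.le
        rw [this]
        exact hGn n
      · exact (hG.2 N).inter (hT.measurableSet_ge N)
    have hQGNc : Q GNᶜ = ∫⁻ ω in GNᶜ, ENNReal.ofReal (Real.exp (-W ω)) ∂P := by
      refine measure_eq_setLIntegral_exp_truncTime (T := T) hQ (fun n hn => ?_) ?_
      · have : GNᶜ ∩ {ω | T ω = n} = {ω | T ω = n} \ (G ∩ {ω | T ω = n}) := by
          ext ω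
          simp only [hGN, Set.mem_inter_iff, Set.mem_ofPred_eq, Set.mem_compl_iff, Set.mem_sdiff]
          constructor
          · rintro ⟨h1, h2⟩
            refine ⟨h2, fun h3 => h1 ⟨h3.1, ?_⟩⟩
            rw [h2, Nat.cast_le]
            exact hn.le
          · rintro ⟨h1, h2⟩
            exact ⟨fun h3 => h2 ⟨h3.1, h1⟩, h1⟩
        rw [this]
        exact (hT.measurableSet_eq n).diff (hGn n)
      · exact (hG.2 N).compl.inter (hT.measurableSet_ge N)
    have hWm : Measurable W := by
      have : W = fun ω => ∑ j ∈ Finset.range N,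
          {ω | (j : WithTop ℕ) < T ω}.indicator (Z j) ω := by
        funext ω; exact sum_range_truncTime _ _ _
      rw [this]
      exact Finset.measurable_fun_sum _ fun j _ =>
        (hZm j).indicator (ℱ.le j _ (measurableSet_lt_stoppingTime hT j))
    have hWi : Integrable W P := integrable_sum_truncTime hT hZ N
    have hEm : AEStronglyMeasurable (fun ω => Real.exp (-W ω)) P :=
      hWm.neg.exp.aestronglyMeasurable
    have hEint : Integrable (fun ω => Real.exp (-W ω)) P := by
      refine ⟨hEm, ?_⟩
      rw [hasFiniteIntegral_iff_ofReal (ae_of_all _ fun _ => (Real.exp_nonneg _)),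
        ← lintegral_add_compl _ hGNm, ← hQGN, ← hQGNc]
      exact ENNReal.add_lt_top.2 ⟨measure_lt_top _ _, measure_lt_top _ _⟩
    have hreal : ∀ S : Set Ω, Q S = ∫⁻ ω in S, ENNReal.ofReal (Real.exp (-W ω)) ∂P →
        ∫ ω in S, Real.exp (-W ω) ∂P = Q.real S := by
      intro S hS
      rw [integral_eq_lintegral_of_nonneg_ae (ae_of_all _ fun _ => Real.exp_nonneg _)
        hEm.restrict, ← hS]
      rfl
    -- The tangent inequality x + 1 ≤ exp x at x = L - W on `GN` and at x = -W off it. Since exp(L)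
    -- α = 1, the two Q-terms are at most 1 each; adding up, the mean of `W` is at least L P(GN) -
    -- 1.
    have h1 : ∫ ω in GN, (L + 1 - Real.exp L * Real.exp (-W ω)) ∂P ≤ ∫ ω in GN, W ω ∂P := by
      refine setIntegral_mono ((integrable_const _).sub (hEint.integrableOn.const_mul _))
        hWi.integrableOn fun ω => ?_
      have := Real.add_one_le_exp (L + -W ω)
      simp only
      rw [← Real.exp_add]
      linarith
    have h2 : ∫ ω in GNᶜ, (1 - Real.exp (-W ω)) ∂P ≤ ∫ ω in GNᶜ, W ω ∂P := by
      refine setIntegral_mono ((integrable_const _).sub hEint.integrableOn)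
        hWi.integrableOn fun ω => ?_
      have := Real.add_one_le_exp (-W ω)
      simp only
      linarith
    rw [integral_sub (integrable_const _) (hEint.integrableOn.const_mul _), integral_const_mul,
      hreal _ hQGN] at h1
    rw [integral_sub (integrable_const _) hEint.integrableOn, hreal _ hQGNc] at h2
    simp only [integral_const, measureReal_restrict_apply_univ, smul_eq_mul, mul_one] at h1 h2
    have hWmean : ∫ ω, W ω ∂P = I * truncMean P T N := by
      rw [hW, integral_sum_truncTime hT hZm hZ hind, truncMean, Finset.mul_sum]
      exact Finset.sum_congr rfl fun j _ => by rw [hmean, mul_comm]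
    rw [← integral_add_compl hGNm hWi] at hWmean
    have hQ1 : Q.real GNᶜ ≤ 1 := measureReal_le_one
    have hPc : P.real GN + P.real GNᶜ = 1 := by
      rw [measureReal_add_measureReal_compl hGNm, probReal_univ]
    have hQα : Q.real GN ≤ α := by
      refine ENNReal.toReal_le_of_le_ofReal hα.le (le_trans ?_ hGQ)
      exact measure_mono Set.inter_subset_left
    have hQL : Real.exp L * Q.real GN ≤ 1 := by
      rw [← hexpL]
      exact mul_le_mul_of_nonneg_left hQα (Real.exp_nonneg _)
    have hEN : truncMean P T N ≤ E := by
      rw [hE]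
      exact (ENNReal.ofReal_le_iff_le_toReal htop).1 (ofReal_truncMean_le hT N)
    have := mul_le_mul_of_nonneg_left hEN hI.le
    nlinarith
  -- Finite mean excludes T = ∞, so {T ≤ N} exhausts `G` up to a null set as N grows.
  have hfin : P {ω | T ω = ⊤} = 0 := measure_eq_top_eq_zero hT htop
  have hmono : Monotone fun N : ℕ => G ∩ {ω | T ω ≤ N} := fun m n hmn ω hω =>
    ⟨hω.1, show T ω ≤ (n : WithTop ℕ) from le_trans hω.2 (Nat.cast_le.2 hmn)⟩
  have hlim : Tendsto (fun N : ℕ => P.real (G ∩ {ω | T ω ≤ N})) atTop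
      (𝓝 (P.real (⋃ N : ℕ, G ∩ {ω | T ω ≤ N}))) :=
    (ENNReal.tendsto_toReal (measure_ne_top _ _)).comp (tendsto_measure_iUnion_atTop hmono)
  have hUc : (⋃ N : ℕ, G ∩ {ω | T ω ≤ N})ᶜ ⊆ Gᶜ ∪ {ω | T ω = ⊤} := by
    intro ω hω
    by_contra hcon
    simp only [Set.mem_union, Set.mem_compl_iff, Set.mem_ofPred_eq, not_or, not_not] at hcon
    obtain h | ⟨t, h⟩ := eq_top_or_natCast (T ω)
    · exact hcon.2 h
    · exact hω (Set.mem_iUnion.2 ⟨t, hcon.1, h.le⟩)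
  have hUm : MeasurableSet (⋃ N : ℕ, G ∩ {ω | T ω ≤ N}) :=
    MeasurableSet.iUnion fun N => ℱ.le N _ (hG.2 N)
  have hUr : 1 - ε ≤ P.real (⋃ N : ℕ, G ∩ {ω | T ω ≤ N}) := by
    have h1 : P (⋃ N : ℕ, G ∩ {ω | T ω ≤ N})ᶜ ≤ ENNReal.ofReal ε := by
      refine (measure_mono hUc).trans ((measure_union_le _ _).trans ?_)
      rw [hfin, add_zero]
      exact hGP
    have h2 : P.real (⋃ N : ℕ, G ∩ {ω | T ω ≤ N})ᶜ ≤ ε := ENNReal.toReal_le_of_le_ofReal hε h1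
    have h3 := probReal_add_probReal_compl hUm (μ := P)
    linarith
  have hend : L * P.real (⋃ N : ℕ, G ∩ {ω | T ω ≤ N}) - 1 ≤ I * E :=
    le_of_tendsto ((hlim.const_mul L).sub_const 1) (Eventually.of_forall hmain)
  rw [ENNReal.ofReal_le_iff_le_toReal htop, ← hE, div_le_iff₀ hI]
  nlinarith

end RandomWalk

namespace StreamModel

-- Densities and the likelihood ratio of one observation

section Density

variable {α : Type*} [MeasurableSpace α] {μ : Measure α} {f g : α → ℝ}

theorem ae_eq_zero_of_withDensity_absolutelyContinuous (hf : Measurable f) (hg : Measurable g)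
    (hf0 : ∀ x, 0 ≤ f x) (h : μ.withDensity (fun x => ENNReal.ofReal (f x)) ≪
      μ.withDensity (fun x => ENNReal.ofReal (g x))) : ∀ᵐ x ∂μ, g x = 0 → f x = 0 := by
  have hm : MeasurableSet {x | g x = 0} := hg (measurableSet_singleton 0)
  have h0 : μ.withDensity (fun x => ENNReal.ofReal (g x)) {x | g x = 0} = 0 := by
    rw [withDensity_apply _ hm, setLIntegral_congr_fun hm (g := fun _ => 0), lintegral_zero]
    intro x hx
    simp only [Set.mem_ofPred_eq] at hx
    simp [hx]
  have h1 := h h0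
  rw [withDensity_apply _ hm, setLIntegral_eq_zero_iff hm hf.ennreal_ofReal] at h1
  filter_upwards [h1] with x hx hgx
  exact le_antisymm (ENNReal.ofReal_eq_zero.1 (hx hgx)) (hf0 x)

/-- By mutual absolute continuity `f` and `g` vanish together almost everywhere. There the
conventional values of quotient and logarithm are harmless, as the outer density `g` is zero;
elsewhere the quotient is positive and exp undoes log. -/
theorem withDensity_eq_withDensity_exp_log (hf : Measurable f) (hg : Measurable g)
    (hf0 : ∀ x, 0 ≤ f x) (hg0 : ∀ x, 0 ≤ g x)
    (hfg : μ.withDensity (fun x => ENNReal.ofReal (f x)) ≪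
      μ.withDensity (fun x => ENNReal.ofReal (g x)))
    (hgf : μ.withDensity (fun x => ENNReal.ofReal (g x)) ≪
      μ.withDensity (fun x => ENNReal.ofReal (f x))) :
    μ.withDensity (fun x => ENNReal.ofReal (f x)) =
      (μ.withDensity fun x => ENNReal.ofReal (g x)).withDensity
        fun x => ENNReal.ofReal (Real.exp (Real.log (f x / g x))) := by
  have hm : Measurable fun x => ENNReal.ofReal (Real.exp (Real.log (f x / g x))) :=
    (hf.div hg).log.exp.ennreal_ofReal
  rw [← withDensity_mul _ hg.ennreal_ofReal hm]
  refine withDensity_congr_ae ?_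
  filter_upwards [ae_eq_zero_of_withDensity_absolutelyContinuous hf hg hf0 hfg,
    ae_eq_zero_of_withDensity_absolutelyContinuous hg hf hg0 hgf] with x h1 h2
  simp only [Pi.mul_apply]
  rw [← ENNReal.ofReal_mul (hg0 x)]
  congr 1
  by_cases hgx : g x = 0
  · rw [hgx, h1 hgx, zero_mul]
  · have hfx : f x ≠ 0 := fun h => hgx (h2 h)
    have h3 : 0 < f x / g x :=
      div_pos (lt_of_le_of_ne (hf0 x) hfx.symm) (lt_of_le_of_ne (hg0 x) (Ne.symm hgx))
    rw [Real.exp_log h3]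
    field_simp

theorem integral_withDensity_ofReal (hf : Measurable f) (hf0 : ∀ x, 0 ≤ f x) (φ : α → ℝ) :
    ∫ x, φ x ∂(μ.withDensity fun x => ENNReal.ofReal (f x)) = ∫ x, φ x * f x ∂μ := by
  rw [integral_withDensity_eq_integral_toReal_smul hf.ennreal_ofReal
    (ae_of_all _ fun _ => ENNReal.ofReal_lt_top)]
  refine integral_congr_ae (ae_of_all _ fun x => ?_)
  simp [ENNReal.toReal_ofReal (hf0 x), mul_comm]

theorem integrable_withDensity_ofReal (hf : Measurable f) (hf0 : ∀ x, 0 ≤ f x) {φ : α → ℝ} :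
    Integrable φ (μ.withDensity fun x => ENNReal.ofReal (f x)) ↔
      Integrable (fun x => φ x * f x) μ := by
  rw [integrable_withDensity_iff hf.ennreal_ofReal (ae_of_all _ fun _ => ENNReal.ofReal_lt_top)]
  simp only [ENNReal.toReal_ofReal (hf0 _)]

end Density

variable {K : ℕ} (M : StreamModel.{u} K)

/-- The log-likelihood ratio of a single observation of stream `k`. -/
def inc (k : Fin K) (x : M.E k) : ℝ := Real.log (M.f₁ k x / M.f₀ k x)

theorem measurable_inc (k : Fin K) : Measurable (M.inc k) :=
  ((M.measurable₁ k).div (M.measurable₀ k)).log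

theorem log_div_eq_neg_inc (k : Fin K) (x : M.E k) :
    Real.log (M.f₀ k x / M.f₁ k x) = -M.inc k x := by
  rw [inc, ← Real.log_inv, inv_div]

instance (k : Fin K) : IsProbabilityMeasure (M.law₀ k) :=
  ⟨by rw [law₀, withDensity_apply _ MeasurableSet.univ, Measure.restrict_univ, M.density₀]⟩

instance (k : Fin K) : IsProbabilityMeasure (M.law₁ k) :=
  ⟨by rw [law₁, withDensity_apply _ MeasurableSet.univ, Measure.restrict_univ, M.density₁]⟩

theorem law₁_eq (k : Fin K) : M.law₁ k =
    (M.law₀ k).withDensity fun x => ENNReal.ofReal (Real.exp (M.inc k x)) :=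
  withDensity_eq_withDensity_exp_log (M.measurable₁ k) (M.measurable₀ k) (M.nonneg₁ k)
    (M.nonneg₀ k) (M.ac₁₀ k) (M.ac₀₁ k)

theorem law₀_eq (k : Fin K) : M.law₀ k =
    (M.law₁ k).withDensity fun x => ENNReal.ofReal (Real.exp (-M.inc k x)) := by
  simp only [← log_div_eq_neg_inc]
  exact withDensity_eq_withDensity_exp_log (M.measurable₀ k) (M.measurable₁ k) (M.nonneg₀ k)
    (M.nonneg₁ k) (M.ac₀₁ k) (M.ac₁₀ k)

theorem integral_inc_law₁ (k : Fin K) : ∫ x, M.inc k x ∂(M.law₁ k) = M.D₁ k :=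
  integral_withDensity_ofReal (M.measurable₁ k) (M.nonneg₁ k) _

theorem integral_inc_law₀ (k : Fin K) : ∫ x, M.inc k x ∂(M.law₀ k) = -M.D₀ k := by
  rw [law₀, integral_withDensity_ofReal (M.measurable₀ k) (M.nonneg₀ k), D₀, ← integral_neg]
  simp only [log_div_eq_neg_inc, neg_mul, neg_neg]

theorem integrable_inc_law₁ (k : Fin K) : Integrable (M.inc k) (M.law₁ k) :=
  (integrable_withDensity_ofReal (M.measurable₁ k) (M.nonneg₁ k)).2 (M.finite₁ k)

theorem integrable_inc_law₀ (k : Fin K) : Integrable (M.inc k) (M.law₀ k) := by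
  refine (integrable_withDensity_ofReal (M.measurable₀ k) (M.nonneg₀ k)).2 ?_
  have := (M.finite₀ k).neg
  refine this.congr (ae_of_all _ fun x => ?_)
  simp [log_div_eq_neg_inc]

theorem memLp_inc_law₀ (h : M.FiniteSecondMoment) (k : Fin K) :
    MemLp (M.inc k) 2 (M.law₀ k) := by
  rw [memLp_two_iff_integrable_sq (M.measurable_inc k).aestronglyMeasurable]
  refine (integrable_withDensity_ofReal (M.measurable₀ k) (M.nonneg₀ k)).2 ?_
  simpa only [log_div_eq_neg_inc, neg_sq] using (h k).1

theorem memLp_inc_law₁ (h : M.FiniteSecondMoment) (k : Fin K) :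
    MemLp (M.inc k) 2 (M.law₁ k) := by
  rw [memLp_two_iff_integrable_sq (M.measurable_inc k).aestronglyMeasurable]
  refine (integrable_withDensity_ofReal (M.measurable₁ k) (M.nonneg₁ k)).2 ?_
  simpa only [log_div_eq_neg_inc, neg_sq] using (h k).2

theorem integral_sq_inc_law₀_le {V : ℝ} (h : M.SecondMomentLE V) (k : Fin K) :
    ∫ x, M.inc k x ^ 2 ∂(M.law₀ k) ≤ V := by
  rw [law₀, integral_withDensity_ofReal (M.measurable₀ k) (M.nonneg₀ k)]
  simpa only [log_div_eq_neg_inc, neg_sq] using (h k).1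

theorem integral_sq_inc_law₁_le {V : ℝ} (h : M.SecondMomentLE V) (k : Fin K) :
    ∫ x, M.inc k x ^ 2 ∂(M.law₁ k) ≤ V := by
  rw [law₁, integral_withDensity_ofReal (M.measurable₁ k) (M.nonneg₁ k)]
  simpa only [log_div_eq_neg_inc, neg_sq] using (h k).2

-- Independence and likelihood ratios of all observations

/-- The law of one observation of stream `k` when `A` is the set of streams with signal. -/
def law (A : Finset (Fin K)) (k : Fin K) : Measure (M.E k) :=
  if k ∈ A then M.law₁ k else M.law₀ k

instance (A : Finset (Fin K)) (k : Fin K) : IsProbabilityMeasure (M.law A k) := by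
  unfold law; split_ifs <;> infer_instance

theorem P_eq (A : Finset (Fin K)) :
    M.P A = Measure.infinitePi fun k => Measure.infinitePi fun _ : ℕ => M.law A k := by
  rw [Measure.infinitePi_eq_pi, P]
  congr! 5

instance (A : Finset (Fin K)) : IsProbabilityMeasure (M.P A) := by
  rw [P_eq]; infer_instance

theorem iIndepFun_coord (A : Finset (Fin K)) :
    iIndepFun (fun (p : Fin K × ℕ) (ω : M.Ω) => ω p.1 p.2) (M.P A) := by
  rw [P_eq]
  exact iIndepFun_uncurry_infinitePi' (X := fun (k : Fin K) (_ : ℕ) (x : M.E k) => x)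
    (fun k _ => M.law A k) fun _ _ => measurable_id

theorem measurePreserving_coord (A : Finset (Fin K)) (k : Fin K) (j : ℕ) :
    MeasurePreserving (fun ω : M.Ω => ω k j) (M.P A) (M.law A k) := by
  rw [P_eq]
  exact (measurePreserving_eval_infinitePi (fun _ : ℕ => M.law A k) j).comp
    (measurePreserving_eval_infinitePi (fun k => Measure.infinitePi fun _ : ℕ => M.law A k) k)

/-- The sign with which stream `k` enters the log-likelihood ratio of `B` against `A`. -/
def sgn (A B : Finset (Fin K)) (k : Fin K) : ℝ :=
  (if k ∈ B then 1 else 0) - (if k ∈ A then 1 else 0)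

/-- The sign is 0 on streams where `A` and `B` agree and ±1 otherwise, so one formula covers all
pairs of configurations. -/
theorem law_eq_withDensity (A B : Finset (Fin K)) (k : Fin K) : M.law B k =
    (M.law A k).withDensity fun x => ENNReal.ofReal (Real.exp (sgn A B k * M.inc k x)) := by
  unfold law sgn
  split_ifs
  · simp
  · simpa using M.law₁_eq k
  · simpa using M.law₀_eq k
  · simp

/-- The log-likelihood ratio of `B` against `A` for the observations at one time. -/
def incLR (A B : Finset (Fin K)) (x : ∀ k, M.E k) : ℝ := ∑ k, sgn A B k * M.inc k (x k)

theorem measurable_incLR (A B : Finset (Fin K)) : Measurable (M.incLR A B) :=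
  Finset.measurable_fun_sum _ fun k _ =>
    ((M.measurable_inc k).comp (measurable_pi_apply k)).const_mul _

/-- The observations of all streams at time `j + 1`. -/
def obs (j : ℕ) (ω : M.Ω) : ∀ k, M.E k := fun k => ω k j

theorem measurable_obs (j : ℕ) : Measurable (M.obs j) := by
  unfold obs; fun_prop

/-- The log-likelihood ratio of `B` against `A` at time `n`. -/
def logLR (A B : Finset (Fin K)) (n : ℕ) (ω : M.Ω) : ℝ :=
  ∑ j ∈ Finset.range n, M.incLR A B (M.obs j ω)

/-- The first `n` observations. -/
def firstObs (n : ℕ) (ω : M.Ω) (p : Fin K × Fin n) : M.E p.1 := ω p.1 p.2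

theorem measurable_firstObs (n : ℕ) : Measurable (M.firstObs n) := by
  unfold firstObs; fun_prop

/-- It suffices to compare rectangles. There indicator times likelihood ratio is a product of
functions of single observations, independent under `P A`, and each factor integrates to the `law B`
measure of a side. -/
theorem map_firstObs_withDensity (A B : Finset (Fin K)) (n : ℕ) :
    ((M.P A).withDensity fun ω => ENNReal.ofReal (Real.exp (M.logLR A B n ω))).map (M.firstObs n) =
      Measure.pi fun p : Fin K × Fin n => M.law B p.1 := by
  symm
  refine Measure.pi_eq fun s hs => ?_
  have hpre : MeasurableSet (M.firstObs n ⁻¹' Set.univ.pi s) :=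
    M.measurable_firstObs n (MeasurableSet.univ_pi hs)
  rw [Measure.map_apply (M.measurable_firstObs n) (MeasurableSet.univ_pi hs),
    withDensity_apply _ hpre, ← lintegral_indicator hpre]
  set φ : ∀ p : Fin K × Fin n, M.E p.1 → ℝ≥0∞ := fun p =>
    (s p).indicator fun x => ENNReal.ofReal (Real.exp (sgn A B p.1 * M.inc p.1 x)) with hφ
  have hφ0 : ∀ p : Fin K × Fin n, Measurable
      fun x => ENNReal.ofReal (Real.exp (sgn A B p.1 * M.inc p.1 x)) := fun p =>
    ((M.measurable_inc p.1).const_mul _).exp.ennreal_ofReal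
  have hφm : ∀ p, Measurable (φ p) := fun p => (hφ0 p).indicator (hs p)
  have hpt : ∀ ω, (M.firstObs n ⁻¹' Set.univ.pi s).indicator
      (fun ω => ENNReal.ofReal (Real.exp (M.logLR A B n ω))) ω =
      ∏ p : Fin K × Fin n, φ p (ω p.1 p.2) := by
    intro ω
    by_cases h : ω ∈ M.firstObs n ⁻¹' Set.univ.pi s
    · rw [Set.indicator_of_mem h]
      have h1 : ∀ p : Fin K × Fin n, φ p (ω p.1 p.2) =
          ENNReal.ofReal (Real.exp (sgn A B p.1 * M.inc p.1 (ω p.1 p.2))) := fun p =>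
        Set.indicator_of_mem (h p (Set.mem_univ p)) _
      simp only [h1]
      rw [← ENNReal.ofReal_prod_of_nonneg fun _ _ => Real.exp_nonneg _, ← Real.exp_sum,
        Fintype.sum_prod_type, Finset.sum_comm, logLR, Finset.sum_range]
      rfl
    · rw [Set.indicator_of_notMem h]
      obtain ⟨p, hp⟩ : ∃ p : Fin K × Fin n, ω p.1 p.2 ∉ s p := by
        by_contra hcon
        push Not at hcon
        exact h fun p _ => hcon p
      exact (Finset.prod_eq_zero (Finset.mem_univ p) (Set.indicator_of_notMem hp _)).symm
  simp only [hpt]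
  have hind : iIndepFun (fun (p : Fin K × Fin n) (ω : M.Ω) => φ p (ω p.1 p.2)) (M.P A) := by
    have hinj : Function.Injective fun p : Fin K × Fin n => ((p.1, (p.2 : ℕ)) : Fin K × ℕ) := by
      rintro ⟨a, b⟩ ⟨c, d⟩ h
      simp only [Prod.mk.injEq] at h
      exact Prod.ext h.1 (Fin.ext h.2)
    exact ((M.iIndepFun_coord A).precomp hinj).comp φ hφm
  rw [lintegral_prod_eq_prod_lintegral_of_indepFun _ _ hind fun p =>
    (hφm p).comp ((measurable_pi_apply _).comp (measurable_pi_apply p.1))]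
  refine Finset.prod_congr rfl fun p _ => ?_
  rw [(M.measurePreserving_coord A p.1 p.2).lintegral_comp (hφm p), hφ,
    lintegral_indicator (hs p), ← withDensity_apply _ (hs p), ← law_eq_withDensity]

theorem ℱ_le_comap_firstObs (n : ℕ) :
    M.ℱ n ≤ MeasurableSpace.comap (M.firstObs n) inferInstance := by
  refine iSup_le fun k => iSup_le fun j => iSup_le fun hj => ?_
  have : (fun ω : M.Ω => ω k j) =
      (fun y : ∀ p : Fin K × Fin n, M.E p.1 => y (k, ⟨j, hj⟩)) ∘ M.firstObs n := rfl
  rw [this, ← MeasurableSpace.comap_comp]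
  exact MeasurableSpace.comap_mono (measurable_pi_apply (k, (⟨j, hj⟩ : Fin n))).comap_le

/-- The likelihood ratio of two signal configurations on the observations up to time `n`. -/
theorem P_eq_setLIntegral_exp_logLR (A B : Finset (Fin K)) (n : ℕ) (G : Set M.Ω)
    (hG : MeasurableSet[M.ℱ n] G) :
    M.P B G = ∫⁻ ω in G, ENNReal.ofReal (Real.exp (M.logLR A B n ω)) ∂(M.P A) := by
  obtain ⟨H, hH, rfl⟩ := M.ℱ_le_comap_firstObs n _ hG
  have hm := M.measurable_firstObs n
  -- For equal configurations the density is 1, so this identifies the law of the first observations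
  -- under `P B` itself.
  have h1 := M.map_firstObs_withDensity B B n
  have h0 : (fun ω => ENNReal.ofReal (Real.exp (M.logLR B B n ω))) = 1 := by
    funext ω
    simp [logLR, incLR, sgn]
  rw [h0, withDensity_one, ← M.map_firstObs_withDensity A B n] at h1
  rw [← withDensity_apply _ (hm hH), ← Measure.map_apply hm hH, h1, Measure.map_apply hm hH]

theorem measurable_coord_ℱ (k : Fin K) {j n : ℕ} (h : j < n) :
    Measurable[M.ℱ n] fun ω : M.Ω => ω k j := by
  refine Measurable.of_comap_le ?_
  exact le_iSup_of_le k (le_iSup_of_le j (le_iSup_of_le h le_rfl))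

theorem measurable_obs_ℱ {j n : ℕ} (h : j < n) : Measurable[M.ℱ n] (M.obs j) :=
  @measurable_pi_lambda _ _ _ (_) _ _ fun k => M.measurable_coord_ℱ k h

/-- `ℱ n` uses the coordinates with index below `n`, and `obs n`, the observation at time n + 1,
those with index `n`: disjoint blocks of an independent family. -/
theorem indep_ℱ_obs (A : Finset (Fin K)) (n : ℕ) :
    Indep (M.ℱ n) (MeasurableSpace.comap (M.obs n) inferInstance) (M.P A) := by
  have h := indep_iSup_of_disjoint (m := fun p : Fin K × ℕ =>
      MeasurableSpace.comap (fun ω : M.Ω => ω p.1 p.2) inferInstance) (μ := M.P A)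
    (S := {p | p.2 < n}) (T := {p | p.2 = n})
    (fun p => Measurable.comap_le ((measurable_pi_apply _).comp (measurable_pi_apply p.1)))
    (M.iIndepFun_coord A).iIndep (by
      rw [Set.disjoint_left]
      intro p hp hp'
      simp only [Set.mem_ofPred_eq] at hp hp'
      omega)
  refine indep_of_indep_of_le_left (indep_of_indep_of_le_right h ?_) ?_
  · rw [← measurable_iff_comap_le]
    refine @measurable_pi_lambda _ _ _ (_) _ _ fun k => ?_
    refine Measurable.of_comap_le ?_
    exact le_iSup₂_of_le (k, n) rfl le_rfl
  · refine iSup_le fun k => iSup_le fun j => iSup_le fun hj => ?_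
    exact le_iSup₂_of_le (f := fun (p : Fin K × ℕ) (_ : p ∈ {p : Fin K × ℕ | p.2 < n}) =>
      MeasurableSpace.comap (fun ω : M.Ω => ω p.1 p.2) inferInstance) (k, j) hj le_rfl

theorem indep_ℱ_comp_obs (A : Finset (Fin K)) (n : ℕ) {φ : (∀ k, M.E k) → ℝ} (hφ : Measurable φ) :
    Indep (M.ℱ n) (MeasurableSpace.comap (fun ω => φ (M.obs n ω)) inferInstance) (M.P A) := by
  refine indep_of_indep_of_le_right (M.indep_ℱ_obs A n) ?_
  exact (hφ.comp (comap_measurable (M.obs n))).comap_le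

end StreamModel

-- Neighbouring configurations: error and sample size bounds

namespace StreamModel

variable {K : ℕ} (M : StreamModel.{u} K) {A : Finset (Fin K)}

theorem sgn_insert {j : Fin K} (hj : j ∉ A) : sgn A (insert j A) = Pi.single j 1 := by
  funext i
  by_cases h : i = j
  · subst h; simp [sgn, hj]
  · simp [sgn, h]

theorem sgn_erase {k : Fin K} (hk : k ∈ A) : sgn A (A.erase k) = -Pi.single k 1 := by
  funext i
  by_cases h : i = k
  · subst h; simp [sgn, hk]
  · simp [sgn, h]

theorem sgn_swap {j k : Fin K} (hj : j ∉ A) (hk : k ∈ A) :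
    sgn A (insert j (A.erase k)) = Pi.single j 1 - Pi.single k 1 := by
  have hjk : j ≠ k := fun h => hj (h ▸ hk)
  funext i
  by_cases h : i = j
  · subst h; simp [sgn, hj, hjk]
  · by_cases h' : i = k
    · subst h'; simp [sgn, hk, h]
    · simp [sgn, h, h']

theorem incLR_insert {j : Fin K} (hj : j ∉ A) (x : ∀ k, M.E k) :
    M.incLR A (insert j A) x = M.inc j (x j) := by
  simp [incLR, sgn_insert hj, Pi.single_apply]

theorem incLR_erase {k : Fin K} (hk : k ∈ A) (x : ∀ k, M.E k) :
    M.incLR A (A.erase k) x = -M.inc k (x k) := by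
  simp [incLR, sgn_erase hk, Pi.single_apply]

theorem incLR_swap {j k : Fin K} (hj : j ∉ A) (hk : k ∈ A) (x : ∀ k, M.E k) :
    M.incLR A (insert j (A.erase k)) x = M.inc j (x j) - M.inc k (x k) := by
  simp [incLR, sgn_swap hj hk, Pi.single_apply, sub_mul, Finset.sum_sub_distrib]

theorem llr_eq_sum (k : Fin K) (n : ℕ) (ω : M.Ω) :
    M.llr k n ω = ∑ j ∈ Finset.range n, M.inc k (M.obs j ω k) := rfl

theorem logLR_insert {j : Fin K} (hj : j ∉ A) (n : ℕ) (ω : M.Ω) :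
    M.logLR A (insert j A) n ω = M.llr j n ω := by
  simp only [logLR, M.incLR_insert hj, llr_eq_sum]

theorem logLR_erase {k : Fin K} (hk : k ∈ A) (n : ℕ) (ω : M.Ω) :
    M.logLR A (A.erase k) n ω = -M.llr k n ω := by
  simp only [logLR, M.incLR_erase hk, llr_eq_sum, Finset.sum_neg_distrib]

theorem logLR_swap {j k : Fin K} (hj : j ∉ A) (hk : k ∈ A) (n : ℕ) (ω : M.Ω) :
    M.logLR A (insert j (A.erase k)) n ω = M.llr j n ω - M.llr k n ω := by
  simp only [logLR, M.incLR_swap hj hk, llr_eq_sum, Finset.sum_sub_distrib]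

theorem measurable_inc_obs_ℱ (k : Fin K) {j n : ℕ} (h : j < n) :
    Measurable[M.ℱ n] fun ω : M.Ω => M.inc k (M.obs j ω k) :=
  (M.measurable_inc k).comp (M.measurable_coord_ℱ k h)

theorem measurable_llr_ℱ (k : Fin K) (n : ℕ) : Measurable[M.ℱ n] (M.llr k n) :=
  Finset.measurable_fun_sum _ fun _ hj => M.measurable_inc_obs_ℱ k (Finset.mem_range.1 hj)

theorem measurable_logLR_ℱ (A B : Finset (Fin K)) (n : ℕ) : Measurable[M.ℱ n] (M.logLR A B n) :=
  Finset.measurable_fun_sum _ fun _ hj =>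
    (M.measurable_incLR A B).comp (M.measurable_obs_ℱ (Finset.mem_range.1 hj))

/-- The mean of the log-likelihood ratio of one observation of stream `k`. -/
def drift (A : Finset (Fin K)) (k : Fin K) : ℝ := if k ∈ A then M.D₁ k else -M.D₀ k

theorem integral_inc_obs (A : Finset (Fin K)) (k : Fin K) (j : ℕ) :
    ∫ ω, M.inc k (M.obs j ω k) ∂(M.P A) = M.drift A k := by
  have h := (M.measurePreserving_coord A k j).map_eq
  have h2 : ∫ x, M.inc k x ∂(M.law A k) = M.drift A k := by
    unfold law drift
    split_ifs
    · exact M.integral_inc_law₁ k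
    · exact M.integral_inc_law₀ k
  rw [← h2, ← h, integral_map (M.measurePreserving_coord A k j).measurable.aemeasurable
    (M.measurable_inc k).aestronglyMeasurable]
  rfl

theorem integrable_inc_obs (A : Finset (Fin K)) (k : Fin K) (j : ℕ) :
    Integrable (fun ω => M.inc k (M.obs j ω k)) (M.P A) := by
  refine (M.measurePreserving_coord A k j).integrable_comp_of_integrable (g := M.inc k) ?_
  unfold law
  split_ifs
  · exact M.integrable_inc_law₁ k
  · exact M.integrable_inc_law₀ k

theorem memLp_inc_obs (h : M.FiniteSecondMoment) (A : Finset (Fin K)) (k : Fin K) (j : ℕ) :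
    MemLp (fun ω => M.inc k (M.obs j ω k)) 2 (M.P A) := by
  refine MemLp.comp_measurePreserving (g := M.inc k) ?_ (M.measurePreserving_coord A k j)
  unfold law
  split_ifs
  · exact M.memLp_inc_law₁ h k
  · exact M.memLp_inc_law₀ h k

theorem integral_sq_inc_obs_le {V : ℝ} (h : M.SecondMomentLE V) (A : Finset (Fin K)) (k : Fin K)
    (j : ℕ) : ∫ ω, M.inc k (M.obs j ω k) ^ 2 ∂(M.P A) ≤ V := by
  have h2 : ∫ x, M.inc k x ^ 2 ∂(M.law A k) ≤ V := by
    unfold law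
    split_ifs
    · exact M.integral_sq_inc_law₁_le h k
    · exact M.integral_sq_inc_law₀_le h k
  rw [← (M.measurePreserving_coord A k j).map_eq,
    integral_map (M.measurePreserving_coord A k j).measurable.aemeasurable
    ((M.measurable_inc k).pow_const 2).aestronglyMeasurable] at h2
  exact h2

/-- The probability that, upon stopping, the log-likelihood ratio of `B` against `A` is large. -/
theorem P_le_exp_neg {T : M.Ω → WithTop ℕ} (hT : IsStoppingTime M.ℱ T) (A B : Finset (Fin K))
    (b : ℝ) : M.P A {ω | T ω ≠ ⊤ ∧ b ≤ M.logLR A B ((T ω).untopD 0) ω} ≤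
      ENNReal.ofReal (Real.exp (-b)) := by
  refine RandomWalk.measure_le_exp_neg (Q := M.P B) (M.P_eq_setLIntegral_exp_logLR A B)
    (τ := fun ω => (T ω).untopD 0) (fun n => ?_) fun ω hω => hω.2
  have : {ω | T ω ≠ ⊤ ∧ b ≤ M.logLR A B ((T ω).untopD 0) ω} ∩ {ω | (T ω).untopD 0 = n} =
      {ω | T ω = n} ∩ {ω | b ≤ M.logLR A B n ω} := by
    ext ω
    simp only [Set.mem_inter_iff, Set.mem_ofPred_eq]
    constructor
    · rintro ⟨⟨h1, h2⟩, h3⟩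
      obtain h | ⟨t, h⟩ := RandomWalk.eq_top_or_natCast (T ω)
      · exact absurd h h1
      · rw [h] at h3 h2
        have ht : t = n := h3
        subst ht
        exact ⟨h, h2⟩
    · rintro ⟨h1, h2⟩
      rw [h1]
      exact ⟨⟨WithTop.coe_ne_top, h2⟩, rfl⟩
  rw [this]
  exact (hT.measurableSet_eq n).inter
    (measurableSet_le measurable_const (M.measurable_logLR_ℱ A B n))

/-- Lower bound for the expected sample size of a test that distinguishes `A` from `B`. -/
theorem ofReal_le_ess {T : M.Ω → WithTop ℕ} (hT : IsStoppingTime M.ℱ T) {A B : Finset (Fin K)}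
    {G : Set M.Ω} (hG : MeasurableSet[hT.measurableSpace] G) {I : ℝ} (hI : 0 < I)
    (hint : ∀ j, Integrable (fun ω => -M.incLR A B (M.obs j ω)) (M.P A))
    (hmean : ∀ j, ∫ ω, -M.incLR A B (M.obs j ω) ∂(M.P A) = I) {ε α : ℝ} (hα : 0 < α)
    (hα1 : α < 1) (hε : 0 ≤ ε) (hGA : M.P A Gᶜ ≤ ENNReal.ofReal ε)
    (hGB : M.P B G ≤ ENNReal.ofReal α) :
    ENNReal.ofReal (((1 - ε) * |Real.log α| - 1) / I) ≤ M.ess A T := by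
  refine RandomWalk.ofReal_le_lintegral_stoppingTime (Q := M.P B) hT
    (Z := fun j ω => -M.incLR A B (M.obs j ω))
    (fun j => ((M.measurable_incLR A B).comp (M.measurable_obs_ℱ j.lt_succ_self)).neg) hint
    (fun j => M.indep_ℱ_comp_obs A j (M.measurable_incLR A B).neg) hI hmean (fun n G hG => ?_) hG
    hα hα1 hε hGA hGB
  rw [M.P_eq_setLIntegral_exp_logLR A B n G hG]
  simp only [Finset.sum_neg_distrib, neg_neg]
  rfl

theorem D₀_pos (k : Fin K) : 0 < M.D₀ k := M.pos₀ k

theorem D₁_pos (k : Fin K) : 0 < M.D₁ k := M.pos₁ k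

variable {M} in
theorem P_mem_le {α β : ℝ} {C : Set (Finset (Fin K))}
    {t : (M.Ω → WithTop ℕ) × (M.Ω → Finset (Fin K))} (ht : t ∈ M.Δ α β C) (hA : A ∈ C) {j : Fin K}
    (hj : j ∉ A) : M.P A {ω | j ∈ t.2 ω} ≤ ENNReal.ofReal α :=
  (measure_mono fun ω h => show ∃ j, j ∉ A ∧ j ∈ t.2 ω from ⟨j, hj, h⟩).trans (ht.2 A hA).1

variable {M} in
theorem P_notMem_le {α β : ℝ} {C : Set (Finset (Fin K))}
    {t : (M.Ω → WithTop ℕ) × (M.Ω → Finset (Fin K))} (ht : t ∈ M.Δ α β C) (hA : A ∈ C) {k : Fin K}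
    (hk : k ∈ A) : M.P A {ω | k ∉ t.2 ω} ≤ ENNReal.ofReal β :=
  (measure_mono fun ω h => show ∃ k, k ∈ A ∧ k ∉ t.2 ω from ⟨k, hk, h⟩).trans (ht.2 A hA).2

/-- The distinguishing event is {k ∈ d}: it fails with probability at most β under `A` and holds
with probability at most α once `k` is noise. Only stream `k` carries information, at rate `D₁ k`.
-/
theorem le_optimalESS_erase {α β : ℝ} (hα : α ∈ Set.Ioo (0 : ℝ) 1) (hβ : β ∈ Set.Ioo (0 : ℝ) 1)
    {C : Set (Finset (Fin K))} (hA : A ∈ C) {k : Fin K} (hk : k ∈ A) (hC : A.erase k ∈ C) :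
    ENNReal.ofReal (((1 - β) * |Real.log α| - 1) / M.D₁ k) ≤ M.optimalESS A (M.Δ α β C) := by
  refine le_iInf₂ fun t ht => ?_
  obtain ⟨hT, -, hd⟩ := ht.1
  have hinc : ∀ x, -M.incLR A (A.erase k) x = M.inc k (x k) := fun x => by
    rw [M.incLR_erase hk, neg_neg]
  refine M.ofReal_le_ess hT (B := A.erase k) (hd k) (M.D₁_pos k) (fun j => ?_) (fun j => ?_)
    hα.1 hα.2 hβ.1.le (P_notMem_le ht hA hk) (P_mem_le ht hC (Finset.notMem_erase k A))
  · simpa only [hinc] using M.integrable_inc_obs A k j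
  · simp only [hinc, M.integral_inc_obs, drift, if_pos hk]

theorem le_optimalESS_insert {α β : ℝ} (hα : α ∈ Set.Ioo (0 : ℝ) 1) (hβ : β ∈ Set.Ioo (0 : ℝ) 1)
    {C : Set (Finset (Fin K))} (hA : A ∈ C) {j : Fin K} (hj : j ∉ A) (hC : insert j A ∈ C) :
    ENNReal.ofReal (((1 - α) * |Real.log β| - 1) / M.D₀ j) ≤ M.optimalESS A (M.Δ α β C) := by
  refine le_iInf₂ fun t ht => ?_
  obtain ⟨hT, -, hd⟩ := ht.1
  refine M.ofReal_le_ess hT (B := insert j A) (hd j).compl (M.D₀_pos j) (fun i => ?_) (fun i => ?_)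
    hβ.1 hβ.2 hα.1.le ?_ (P_notMem_le ht hC (Finset.mem_insert_self j A))
  · simp only [M.incLR_insert hj]
    exact (M.integrable_inc_obs A j i).neg
  · simp only [M.incLR_insert hj, integral_neg, M.integral_inc_obs, drift, if_neg hj, neg_neg]
  · rw [compl_compl]
    exact P_mem_le ht hA hj

/-- Meant for classes of fixed cardinality, which no single removal or insertion preserves. Two
streams change law, so their informations add up and the bound drops accordingly. -/
theorem le_optimalESS_swap {α β : ℝ} (hα : α ∈ Set.Ioo (0 : ℝ) 1) (hβ : β ∈ Set.Ioo (0 : ℝ) 1)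
    {C : Set (Finset (Fin K))} (hA : A ∈ C) {j k : Fin K} (hj : j ∉ A) (hk : k ∈ A)
    (hC : insert j (A.erase k) ∈ C) :
    ENNReal.ofReal (((1 - α) * |Real.log β| - 1) / (M.D₁ k + M.D₀ j)) ≤
      M.optimalESS A (M.Δ α β C) := by
  refine le_iInf₂ fun t ht => ?_
  obtain ⟨hT, -, hd⟩ := ht.1
  have hinc : ∀ x, -M.incLR A (insert j (A.erase k)) x = M.inc k (x k) - M.inc j (x j) :=
    fun x => by rw [M.incLR_swap hj hk, neg_sub]
  refine M.ofReal_le_ess hT (B := insert j (A.erase k)) (hd j).compl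
    (add_pos (M.D₁_pos k) (M.D₀_pos j)) (fun i => ?_) (fun i => ?_)
    hβ.1 hβ.2 hα.1.le ?_ (P_notMem_le ht hC (Finset.mem_insert_self j _))
  · simp only [hinc]
    exact (M.integrable_inc_obs A k i).sub (M.integrable_inc_obs A j i)
  · simp only [hinc]
    rw [integral_sub (M.integrable_inc_obs A k i) (M.integrable_inc_obs A j i),
      M.integral_inc_obs, M.integral_inc_obs, drift, drift, if_pos hk, if_neg hj, sub_neg_eq_add]
  · rw [compl_compl]
    exact P_mem_le ht hA hj

end StreamModel

-- First entrance times of the vector of log-likelihood ratios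

namespace StreamModel

variable {K : ℕ} (M : StreamModel.{u} K) {A : Finset (Fin K)}

/-- The vector of the log-likelihood ratios of all streams. -/
def llrVec (n : ℕ) (ω : M.Ω) : Fin K → ℝ := fun k => M.llr k n ω

theorem adapted_llrVec : Adapted M.ℱ M.llrVec := fun n =>
  @measurable_pi_lambda _ _ _ (_) _ _ fun k => M.measurable_llr_ℱ k n

theorem measurableSet_of_decision {T : M.Ω → WithTop ℕ} (hT : IsStoppingTime M.ℱ T)
    {D : Set (Fin K → ℝ)} (hD : MeasurableSet D) :
    MeasurableSet[hT.measurableSpace] {ω | M.llrVec ((T ω).untopD 0) ω ∈ D} := by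
  set S := {ω | M.llrVec ((T ω).untopD 0) ω ∈ D} with hS
  have hn : ∀ n : ℕ, S ∩ {ω | T ω = n} = (M.llrVec n ⁻¹' D) ∩ {ω | T ω = n} := by
    intro n
    ext ω
    simp only [hS, Set.mem_inter_iff, Set.mem_ofPred_eq, Set.mem_preimage, and_congr_left_iff]
    intro h
    rw [h]
    rfl
  have hnm : ∀ n : ℕ, MeasurableSet[M.ℱ n] (S ∩ {ω | T ω = n}) := by
    intro n
    rw [hn]
    exact (M.adapted_llrVec n hD).inter (hT.measurableSet_eq n)
  have hle : ∀ n : ℕ, M.ℱ n ≤ ⨆ t, M.ℱ t := fun n => le_iSup (fun t => M.ℱ t) n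
  have htop : MeasurableSet[⨆ t, M.ℱ t] (S ∩ {ω | T ω = ⊤}) := by
    have h1 : {ω | T ω = ⊤} = (⋃ n : ℕ, {ω | T ω = n})ᶜ := by
      ext ω
      simp only [Set.mem_ofPred_eq, Set.mem_compl_iff, Set.mem_iUnion, not_exists]
      constructor
      · intro h n
        rw [h]
        exact (WithTop.natCast_ne_top n).symm
      · intro h
        obtain h' | ⟨t, h'⟩ := RandomWalk.eq_top_or_natCast (T ω)
        · exact h'
        · exact absurd h' (h t)
    -- On {T = ∞} the default time is 0, where all sums are empty; the decision is therefore the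
    -- same for all such ω.
    have h2 : S ∩ {ω | T ω = ⊤} = {ω | (0 : Fin K → ℝ) ∈ D} ∩ {ω | T ω = ⊤} := by
      ext ω
      simp only [hS, Set.mem_inter_iff, Set.mem_ofPred_eq, and_congr_left_iff]
      intro h
      have h0 : M.llrVec ((T ω).untopD 0) ω = 0 := by
        funext k
        rw [h]
        simp [llrVec, llr]
      rw [h0]
    rw [h2, h1]
    refine @MeasurableSet.inter _ (_) _ _ (@MeasurableSet.const _ (_) _) ?_
    refine @MeasurableSet.compl _ _ (_) ?_
    exact @MeasurableSet.iUnion _ _ (_) _ _ fun n => hle n _ (hT.measurableSet_eq n)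
  refine ⟨?_, fun i => ?_⟩
  · have : S = (⋃ n : ℕ, S ∩ {ω | T ω = n}) ∪ (S ∩ {ω | T ω = ⊤}) := by
      ext ω
      simp only [Set.mem_union, Set.mem_iUnion, Set.mem_inter_iff, Set.mem_ofPred_eq]
      constructor
      · intro h
        obtain h' | ⟨t, h'⟩ := RandomWalk.eq_top_or_natCast (T ω)
        · exact Or.inr ⟨h, h'⟩
        · exact Or.inl ⟨t, h, h'⟩
      · rintro (⟨_, h, _⟩ | ⟨h, _⟩) <;> exact h
    rw [this]
    refine @MeasurableSet.union _ (_) _ _ ?_ htop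
    exact @MeasurableSet.iUnion _ _ (_) _ _ fun n => hle n _ (hnm n)
  · have : S ∩ {ω | T ω ≤ i} = ⋃ n : ℕ, ⋃ _ : n ≤ i, S ∩ {ω | T ω = n} := by
      ext ω
      simp only [Set.mem_iUnion, Set.mem_inter_iff, Set.mem_ofPred_eq, exists_prop]
      constructor
      · rintro ⟨h1, h2⟩
        obtain h' | ⟨t, h'⟩ := RandomWalk.eq_top_or_natCast (T ω)
        · rw [h'] at h2
          exact absurd h2 (by simp)
        · rw [h'] at h2
          exact ⟨t, WithTop.coe_le_coe.1 h2, h1, h'⟩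
      · rintro ⟨n, h1, h2, h3⟩
        refine ⟨h2, ?_⟩
        rw [h3]
        exact WithTop.coe_le_coe.2 h1
    change MeasurableSet[M.ℱ i] (S ∩ {ω | T ω ≤ (i : WithTop ℕ)})
    rw [this]
    exact MeasurableSet.iUnion fun n => MeasurableSet.iUnion fun h => M.ℱ.mono h _ (hnm n)

/-- The first `n ≥ 1` at which the vector of log-likelihood ratios is in `s`. -/
def firstTime (s : Set (Fin K → ℝ)) : M.Ω → WithTop ℕ := hittingAfter M.llrVec s 1

theorem isStoppingTime_firstTime {s : Set (Fin K → ℝ)} (hs : MeasurableSet s) :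
    IsStoppingTime M.ℱ (M.firstTime s) :=
  M.adapted_llrVec.isStoppingTime_hittingAfter hs

theorem one_le_firstTime (s : Set (Fin K → ℝ)) (ω : M.Ω) : 1 ≤ M.firstTime s ω :=
  le_hittingAfter ω

theorem llrVec_notMem_of_lt {s : Set (Fin K → ℝ)} {ω : M.Ω} {n : ℕ} (hn : 1 ≤ n)
    (h : (n : WithTop ℕ) < M.firstTime s ω) : M.llrVec n ω ∉ s :=
  notMem_of_lt_hittingAfter h hn

theorem llrVec_firstTime_mem {s : Set (Fin K → ℝ)} {ω : M.Ω} (h : M.firstTime s ω ≠ ⊤) :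
    M.llrVec ((M.firstTime s ω).untopD 0) ω ∈ s := by
  have h1 := hittingAfter_mem_set_of_ne_top h
  obtain h' | ⟨t, h'⟩ := RandomWalk.eq_top_or_natCast (M.firstTime s ω)
  · exact absurd h' h
  · have h2 : (hittingAfter M.llrVec s 1 ω) = (t : WithTop ℕ) := h'
    rw [h']
    simp only [h2] at h1
    exact h1

theorem isSequentialTest_firstTime {s : Set (Fin K → ℝ)} (hs : MeasurableSet s)
    {d : M.Ω → Finset (Fin K)} {D : Fin K → Set (Fin K → ℝ)} (hD : ∀ k, MeasurableSet (D k))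
    (hd : ∀ k ω, k ∈ d ω ↔ M.llrVec ((M.firstTime s ω).untopD 0) ω ∈ D k) :
    M.IsSequentialTest (M.firstTime s, d) := by
  refine ⟨M.isStoppingTime_firstTime hs, M.one_le_firstTime s, fun k => ?_⟩
  have : {ω | k ∈ d ω} = {ω | M.llrVec ((M.firstTime s ω).untopD 0) ω ∈ D k} := by
    ext ω; exact hd k ω
  change MeasurableSet[(M.isStoppingTime_firstTime hs).measurableSpace] {ω | k ∈ d ω}
  rw [this]
  exact M.measurableSet_of_decision _ (hD k)

-- The intersection rule

section Intersection

/-- The vectors at which the intersection rule stops. -/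
def outside (K : ℕ) (a b : ℝ) : Set (Fin K → ℝ) := {v | ∀ k, v k ∉ Set.Ioo (-a) b}

theorem measurableSet_outside (a b : ℝ) : MeasurableSet (outside K a b) := by
  have : outside K a b = ⋂ k, {v : Fin K → ℝ | v k ∈ (Set.Ioo (-a) b)ᶜ} := by
    ext v; simp [outside]
  rw [this]
  exact MeasurableSet.iInter fun k => (measurable_pi_apply k) measurableSet_Ioo.compl

theorem mem_intersectionDecision {a b : ℝ} {k : Fin K} {ω : M.Ω} :
    k ∈ M.intersectionDecision a b ω ↔
      0 < M.llr k ((M.firstTime (outside K a b) ω).untopD 0) ω := by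
  rw [intersectionDecision, Finset.mem_filter]
  exact and_iff_right (Finset.mem_univ _)

theorem isSequentialTest_intersection (a b : ℝ) :
    M.IsSequentialTest (M.intersectionTime a b, M.intersectionDecision a b) :=
  M.isSequentialTest_firstTime (measurableSet_outside a b) (D := fun k => {v | 0 < v k})
    (fun k => measurableSet_lt measurable_const (measurable_pi_apply k))
    fun _ _ => M.mem_intersectionDecision

/-- Give each walk the sign of its drift. While the rule continues, some ratio lies in (-a, b), so
the signed walk of that stream is below `b` (signal) or `a` (noise). Leaving the interval on the
wrong side can only make the rule stop sooner. -/
theorem ess_intersectionTime_le (hK : 1 ≤ K) (hM : M.FiniteSecondMoment) {V δ a b H : ℝ}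
    (hV : 0 < V) (hsq : M.SecondMomentLE V) (hδ : 0 < δ) (hD : ∀ k, δ ≤ M.D₀ k ∧ δ ≤ M.D₁ k)
    (ha : 0 < a) (hb : 0 < b) (h1 : ∀ k ∈ A, b ≤ H * M.D₁ k) (h0 : ∀ k ∉ A, a ≤ H * M.D₀ k) :
    M.ess A (M.intersectionTime a b) ≤
      ENNReal.ofReal (H + (K * (2 * √V / δ)) * √H + (K * (2 * √V / δ)) ^ 2) := by
  have : Nonempty (Fin K) := ⟨⟨0, hK⟩⟩
  set ε : Fin K → ℝ := fun k => if k ∈ A then 1 else -1 with hε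
  have hmeas : ∀ k, Measurable fun x : ∀ k, M.E k => ε k * M.inc k (x k) := fun k =>
    ((M.measurable_inc k).comp (measurable_pi_apply k)).const_mul _
  have hε2 : ∀ k, ε k ^ 2 = 1 := by
    intro k
    simp only [hε]
    split_ifs <;> norm_num
  have := RandomWalk.lintegral_stoppingTime_le (P := M.P A) (V := V) (δ := δ) (H := H)
    (M.isStoppingTime_firstTime (measurableSet_outside a b)) (M.one_le_firstTime _)
    (Y := fun k j ω => ε k * M.inc k (M.obs j ω k))
    (m := fun k => if k ∈ A then M.D₁ k else M.D₀ k) (c := fun k => if k ∈ A then b else a)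
    (fun k j => (M.measurable_inc_obs_ℱ k j.lt_succ_self).const_mul _)
    (fun k j => (M.memLp_inc_obs hM A k j).const_mul _)
    (fun k j => M.indep_ℱ_comp_obs A j (hmeas k)) (fun k j => ?_) hV (fun k j => ?_) hδ
    (fun k => ?_) (fun k => ?_) (fun k => ?_) (fun ω n hn hlt => ?_)
  · rwa [Fintype.card_fin] at this
  · rw [integral_const_mul, M.integral_inc_obs, drift]
    simp only [hε]
    split_ifs <;> ring
  · simp only [mul_pow, hε2, one_mul]
    exact M.integral_sq_inc_obs_le hsq A k j
  · split_ifs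
    exacts [(hD k).2, (hD k).1]
  · split_ifs
    exacts [hb, ha]
  · split_ifs with h
    exacts [h1 k h, h0 k h]
  · have h := M.llrVec_notMem_of_lt hn hlt
    simp only [outside, Set.mem_ofPred_eq, not_forall, not_not] at h
    obtain ⟨k, hk⟩ := h
    refine ⟨k, ?_⟩
    rw [← Finset.mul_sum, ← M.llr_eq_sum]
    simp only [hε]
    have hk1 : -a < M.llr k n ω := hk.1
    have hk2 : M.llr k n ω < b := hk.2
    split_ifs <;> linarith

/-- Familywise error control of the intersection rule. -/
theorem intersection_mem_Δ {a b α β : ℝ} (ha : 0 < a) (hb : 0 < b)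
    (haβ : K * Real.exp (-a) ≤ β) (hbα : K * Real.exp (-b) ≤ α)
    (hfin : ∀ A, M.P A {ω | M.intersectionTime a b ω = ⊤} = 0) (C : Set (Finset (Fin K))) :
    (M.intersectionTime a b, M.intersectionDecision a b) ∈ M.Δ α β C := by
  refine ⟨M.isSequentialTest_intersection a b, fun A _ => ⟨?_, ?_⟩⟩
  · set T := M.firstTime (outside K a b) with hT
    have hTs := M.isStoppingTime_firstTime (measurableSet_outside (K := K) a b)
    -- A ratio that is positive and outside (-a, b) is at least `b`. If the rule never stops,
    -- nothing is declared, so no false positive arises there.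
    have hsub : {ω | ∃ j, j ∉ A ∧ j ∈ M.intersectionDecision a b ω} ⊆
        ⋃ j ∈ Finset.univ.filter (· ∉ A),
          {ω | T ω ≠ ⊤ ∧ b ≤ M.logLR A (insert j A) ((T ω).untopD 0) ω} := by
      rintro ω ⟨j, hj, hjd⟩
      rw [mem_intersectionDecision] at hjd
      simp only [Set.mem_iUnion, Finset.mem_filter, Finset.mem_univ, true_and]
      refine ⟨j, hj, ?_⟩
      have hne : T ω ≠ ⊤ := by
        intro h
        rw [hT] at h
        rw [h] at hjd
        simp [llr] at hjd
      refine ⟨hne, ?_⟩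
      rw [M.logLR_insert hj]
      have := M.llrVec_firstTime_mem hne j
      by_contra hlt
      exact this ⟨lt_trans (by linarith) hjd, not_le.1 hlt⟩
    refine (measure_mono hsub).trans ((measure_biUnion_finset_le _ _).trans ?_)
    refine (Finset.sum_le_sum fun j _ => M.P_le_exp_neg hTs A (insert j A) b).trans ?_
    rw [Finset.sum_const, nsmul_eq_mul, ← ENNReal.ofReal_natCast,
      ← ENNReal.ofReal_mul (Nat.cast_nonneg _)]
    refine ENNReal.ofReal_le_ofReal (le_trans ?_ hbα)
    have hcard := (Finset.univ.filter (· ∉ A)).card_le_univ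
    rw [Fintype.card_fin] at hcard
    gcongr
  · set T := M.firstTime (outside K a b) with hT
    have hTs := M.isStoppingTime_firstTime (measurableSet_outside (K := K) a b)
    -- A rule that never stops misses every signal, so here the event {T = ∞} must be included; it
    -- is null by `hfin`.
    have hsub : {ω | ∃ k, k ∈ A ∧ k ∉ M.intersectionDecision a b ω} ⊆
        {ω | M.intersectionTime a b ω = ⊤} ∪ ⋃ k ∈ A,
          {ω | T ω ≠ ⊤ ∧ a ≤ M.logLR A (A.erase k) ((T ω).untopD 0) ω} := by
      rintro ω ⟨k, hk, hkd⟩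
      rw [mem_intersectionDecision, not_lt] at hkd
      by_cases hne : T ω = ⊤
      · exact Or.inl hne
      · refine Or.inr ?_
        simp only [Set.mem_iUnion]
        refine ⟨k, hk, hne, ?_⟩
        rw [M.logLR_erase hk]
        have := M.llrVec_firstTime_mem hne k
        by_contra hlt
        refine this ⟨?_, lt_of_le_of_lt hkd hb⟩
        change -a < M.llr k _ ω
        linarith
    refine (measure_mono hsub).trans ((measure_union_le _ _).trans ?_)
    rw [hfin, zero_add]
    refine (measure_biUnion_finset_le _ _).trans ?_
    refine (Finset.sum_le_sum fun k _ => M.P_le_exp_neg hTs A (A.erase k) a).trans ?_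
    rw [Finset.sum_const, nsmul_eq_mul, ← ENNReal.ofReal_natCast,
      ← ENNReal.ofReal_mul (Nat.cast_nonneg _)]
    refine ENNReal.ofReal_le_ofReal (le_trans ?_ haβ)
    have hcard := A.card_le_univ
    rw [Fintype.card_fin] at hcard
    gcongr

end Intersection

-- The gap rule for a known number of signals

section Gap

/-- `S` consists of `m` streams that lead all other streams by at least `c`. -/
def Leads (m : ℕ) (c : ℝ) (v : Fin K → ℝ) (S : Finset (Fin K)) : Prop :=
  S.card = m ∧ ∀ k ∈ S, ∀ j ∉ S, c ≤ v k - v j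

theorem exists_mem_notMem_of_card_eq {S S' : Finset (Fin K)} (h : S.card = S'.card) (hne : S ≠ S') :
    ∃ k, k ∈ S ∧ k ∉ S' := by
  by_contra hcon
  push Not at hcon
  exact hne (Finset.eq_of_subset_of_card_le hcon h.ge)

/-- Two distinct sets of equal size each contain a stream missing from the other, and each of these
two streams would lead the other by c > 0. -/
theorem Leads.unique {m : ℕ} {c : ℝ} (hc : 0 < c) {v : Fin K → ℝ} {S S' : Finset (Fin K)}
    (h : Leads m c v S) (h' : Leads m c v S') : S = S' := by
  by_contra hne
  obtain ⟨k, hk, hk'⟩ := exists_mem_notMem_of_card_eq (h.1.trans h'.1.symm) hne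
  obtain ⟨j, hj', hj⟩ := exists_mem_notMem_of_card_eq (h'.1.trans h.1.symm) (Ne.symm hne)
  have h1 := h.2 k hk j hj
  have h2 := h'.2 j hj' k hk'
  linarith

theorem measurableSet_leads (m : ℕ) (c : ℝ) (S : Finset (Fin K)) :
    MeasurableSet {v : Fin K → ℝ | Leads m c v S} := by
  have : {v : Fin K → ℝ | Leads m c v S} = {_v | S.card = m} ∩
      ⋂ k, ⋂ (_ : k ∈ S), ⋂ j, ⋂ (_ : j ∉ S), {v | c ≤ v k - v j} := by
    ext v; simp [Leads]
  rw [this]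
  refine (MeasurableSet.const _).inter ?_
  refine MeasurableSet.iInter fun k => MeasurableSet.iInter fun _ => MeasurableSet.iInter fun j =>
    MeasurableSet.iInter fun _ => ?_
  exact measurableSet_le measurable_const ((measurable_pi_apply k).sub (measurable_pi_apply j))

/-- The vectors at which the gap rule stops. -/
def gapSet (K m : ℕ) (c : ℝ) : Set (Fin K → ℝ) := {v | ∃ S, Leads m c v S}

theorem measurableSet_gapSet (m : ℕ) (c : ℝ) : MeasurableSet (gapSet K m c) := by
  have : gapSet K m c = ⋃ S, {v : Fin K → ℝ | Leads m c v S} := by ext v; simp [gapSet]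
  rw [this]
  exact MeasurableSet.iUnion fun S => measurableSet_leads m c S

open Classical in
/-- The set of leading streams, or `S₀` if there is no clear lead. -/
def leaders (m : ℕ) (c : ℝ) (S₀ : Finset (Fin K)) (v : Fin K → ℝ) : Finset (Fin K) :=
  if h : ∃ S, Leads m c v S then h.choose else S₀

theorem leaders_eq {m : ℕ} {c : ℝ} (hc : 0 < c) (S₀ : Finset (Fin K)) {v : Fin K → ℝ}
    {S : Finset (Fin K)} (h : Leads m c v S) : leaders m c S₀ v = S := by
  have hex : ∃ S, Leads m c v S := ⟨S, h⟩
  rw [leaders, dif_pos hex]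
  exact hex.choose_spec.unique hc h

theorem card_leaders {m : ℕ} {c : ℝ} {S₀ : Finset (Fin K)} (h₀ : S₀.card = m) (v : Fin K → ℝ) :
    (leaders m c S₀ v).card = m := by
  unfold leaders
  split_ifs with h
  · exact h.choose_spec.1
  · exact h₀

theorem measurableSet_mem_leaders (m : ℕ) {c : ℝ} (hc : 0 < c) (S₀ : Finset (Fin K)) (k : Fin K) :
    MeasurableSet {v | k ∈ leaders m c S₀ v} := by
  have : {v | k ∈ leaders m c S₀ v} = (⋃ S, {v : Fin K → ℝ | Leads m c v S} ∩ {_v | k ∈ S}) ∪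
      ((gapSet K m c)ᶜ ∩ {_v | k ∈ S₀}) := by
    ext v
    simp only [Set.mem_ofPred_eq, Set.mem_union, Set.mem_iUnion, Set.mem_inter_iff,
      Set.mem_compl_iff]
    by_cases hex : ∃ S, Leads m c v S
    · obtain ⟨S, hS⟩ := hex
      rw [leaders_eq hc S₀ hS]
      constructor
      · exact fun h => Or.inl ⟨S, hS, h⟩
      · rintro (⟨S', hS', h⟩ | ⟨h, _⟩)
        · rwa [hS.unique hc hS']
        · exact absurd ⟨S, hS⟩ h
    · rw [leaders, dif_neg hex]
      constructor
      · exact fun h => Or.inr ⟨hex, h⟩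
      · rintro (⟨S', hS', _⟩ | ⟨_, h⟩)
        · exact absurd ⟨S', hS'⟩ hex
        · exact h
  rw [this]
  exact (MeasurableSet.iUnion fun S => (measurableSet_leads m c S).inter (.const _)).union
    ((measurableSet_gapSet m c).compl.inter (.const _))

/-- The gap rule: stop when `m` streams lead all others by at least `c`, and select these. -/
def gapRule (m : ℕ) (c : ℝ) (S₀ : Finset (Fin K)) :
    (M.Ω → WithTop ℕ) × (M.Ω → Finset (Fin K)) :=
  (M.firstTime (gapSet K m c),
    fun ω => leaders m c S₀ (M.llrVec ((M.firstTime (gapSet K m c) ω).untopD 0) ω))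

theorem isSequentialTest_gapRule (m : ℕ) {c : ℝ} (hc : 0 < c) (S₀ : Finset (Fin K)) :
    M.IsSequentialTest (M.gapRule m c S₀) :=
  M.isSequentialTest_firstTime (measurableSet_gapSet m c)
    (fun k => measurableSet_mem_leaders m hc S₀ k) fun _ _ => Iff.rfl

/-- The pairs of a stream with signal and a stream without signal. -/
abbrev SignalNoisePair (A : Finset (Fin K)) : Type := {p : Fin K × Fin K // p.1 ∈ A ∧ p.2 ∉ A}

/-- The walks are the differences λ^k - λ^j over signal-noise pairs, with drift 2D and increments of
second moment at most 4V. Once all of them reach `c`, the set `A` itself leads, so the rule has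
stopped. -/
theorem ess_gapRule_le (hM : M.FiniteSecondMoment) {V D c : ℝ} (hV : 0 < V)
    (hsq : M.SecondMomentLE V) (hD0 : 0 < D) (hD : ∀ k, M.D₀ k = D ∧ M.D₁ k = D) (hc : 0 < c)
    {m : ℕ} (hm : A.card = m) (S₀ : Finset (Fin K)) [Nonempty (SignalNoisePair A)] :
    M.ess A (M.gapRule m c S₀).1 ≤
      ENNReal.ofReal (c / (2 * D) +
        (Fintype.card (SignalNoisePair A) * (2 * √(4 * V) / (2 * D))) * √(c / (2 * D)) +
        (Fintype.card (SignalNoisePair A) * (2 * √(4 * V) / (2 * D))) ^ 2) := by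
  have hmeas : ∀ p : SignalNoisePair A,
      Measurable fun x : ∀ k, M.E k => M.inc p.1.1 (x p.1.1) - M.inc p.1.2 (x p.1.2) := fun p =>
    ((M.measurable_inc _).comp (measurable_pi_apply _)).sub
      ((M.measurable_inc _).comp (measurable_pi_apply _))
  refine RandomWalk.lintegral_stoppingTime_le (P := M.P A) (ι := SignalNoisePair A)
    (M.isStoppingTime_firstTime (measurableSet_gapSet m c)) (M.one_le_firstTime _)
    (Y := fun p j ω => M.inc p.1.1 (M.obs j ω p.1.1) - M.inc p.1.2 (M.obs j ω p.1.2))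
    (m := fun _ => 2 * D) (c := fun _ => c)
    (fun p j => (M.measurable_inc_obs_ℱ _ j.lt_succ_self).sub
      (M.measurable_inc_obs_ℱ _ j.lt_succ_self))
    (fun p j => (M.memLp_inc_obs hM A _ j).sub (M.memLp_inc_obs hM A _ j))
    (fun p j => M.indep_ℱ_comp_obs A j (hmeas p)) (fun p j => ?_) (by positivity)
    (fun p j => ?_) (by positivity) (fun _ => le_rfl) (fun _ => hc) (fun _ => ?_)
    (fun ω n hn hlt => ?_)
  · rw [integral_sub (M.integrable_inc_obs A _ j) (M.integrable_inc_obs A _ j),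
      M.integral_inc_obs, M.integral_inc_obs, drift, drift, if_pos p.2.1, if_neg p.2.2,
      (hD _).1, (hD _).2]
    ring
  · have h1 := (M.memLp_inc_obs hM A p.1.1 j).integrable_sq.const_mul 2
    have h2 := (M.memLp_inc_obs hM A p.1.2 j).integrable_sq.const_mul 2
    calc _ ≤ ∫ ω, (2 * M.inc p.1.1 (M.obs j ω p.1.1) ^ 2 + 2 * M.inc p.1.2 (M.obs j ω p.1.2) ^ 2)
          ∂(M.P A) := by
          refine integral_mono ((M.memLp_inc_obs hM A _ j).sub
            (M.memLp_inc_obs hM A _ j)).integrable_sq (h1.add h2) fun ω => ?_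
          simp only
          nlinarith [sq_nonneg (M.inc p.1.1 (M.obs j ω p.1.1) + M.inc p.1.2 (M.obs j ω p.1.2))]
      _ ≤ 4 * V := by
          rw [integral_add h1 h2, integral_const_mul, integral_const_mul]
          linarith [M.integral_sq_inc_obs_le hsq A p.1.1 j, M.integral_sq_inc_obs_le hsq A p.1.2 j]
  · rw [div_mul_cancel₀]
    positivity
  · have h := M.llrVec_notMem_of_lt hn hlt
    by_contra hcon
    push Not at hcon
    refine h ⟨A, hm, fun k hk j hj => ?_⟩
    have := hcon ⟨(k, j), hk, hj⟩
    simp only [Finset.sum_sub_distrib, ← M.llr_eq_sum] at this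
    exact this

/-- Error control of the gap rule. -/
theorem gapRule_mem_ΔExactly {m : ℕ} {c α β : ℝ} (hc : 0 < c)
    (hcα : (m * (K - m) : ℕ) * Real.exp (-c) ≤ min α β) {S₀ : Finset (Fin K)} (h₀ : S₀.card = m)
    (hfin : ∀ A ∈ classExactly K m, M.P A {ω | (M.gapRule m c S₀).1 ω = ⊤} = 0) :
    M.gapRule m c S₀ ∈ M.ΔExactly α β m := by
  refine ⟨M.isSequentialTest_gapRule m hc S₀, fun ω => card_leaders h₀ _, fun A hA => ?_⟩
  set T := M.firstTime (gapSet K m c) with hT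
  have hTs := M.isStoppingTime_firstTime (measurableSet_gapSet (K := K) m c)
  have hAm : A.card = m := hA
  -- A wrong selection has the right size, hence omits some k ∈ A and includes some j ∉ A; then λ^j
  -- - λ^k ≥ c, which is the log-likelihood ratio of the exchange against `A`.
  have hsub : {ω | (M.gapRule m c S₀).2 ω ≠ A} ⊆
      {ω | (M.gapRule m c S₀).1 ω = ⊤} ∪ ⋃ p ∈ A ×ˢ Aᶜ, {ω | T ω ≠ ⊤ ∧
        c ≤ M.logLR A (insert p.2 (A.erase p.1)) ((T ω).untopD 0) ω} := by
    intro ω hω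
    by_cases hne : T ω = ⊤
    · exact Or.inl hne
    · refine Or.inr ?_
      obtain ⟨S, hS⟩ := M.llrVec_firstTime_mem hne
      have hd : (M.gapRule m c S₀).2 ω = S := leaders_eq hc S₀ hS
      have hSA : S ≠ A := fun h => hω (hd.trans h)
      obtain ⟨k, hk, hk'⟩ := exists_mem_notMem_of_card_eq (hAm.trans hS.1.symm) hSA.symm
      obtain ⟨j, hj', hj⟩ := exists_mem_notMem_of_card_eq (hS.1.trans hAm.symm) hSA
      simp only [Set.mem_iUnion]
      refine ⟨(k, j), Finset.mem_product.2 ⟨hk, Finset.mem_compl.2 hj⟩, hne, ?_⟩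
      rw [M.logLR_swap hj hk]
      exact hS.2 j hj' k hk'
  refine (measure_mono hsub).trans ((measure_union_le _ _).trans ?_)
  rw [hfin A hA, zero_add]
  refine (measure_biUnion_finset_le _ _).trans ?_
  refine (Finset.sum_le_sum fun p _ => M.P_le_exp_neg hTs A _ c).trans ?_
  rw [Finset.sum_const, nsmul_eq_mul, ← ENNReal.ofReal_natCast,
    ← ENNReal.ofReal_mul (Nat.cast_nonneg _), Finset.card_product, Finset.card_compl,
    Fintype.card_fin, hAm]
  exact ENNReal.ofReal_le_ofReal hcα

theorem ΔExactly_subset_Δ (α β : ℝ) (m : ℕ) : M.ΔExactly α β m ⊆ M.Δ α β (classExactly K m) := by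
  rintro t ⟨h1, _, h3⟩
  refine ⟨h1, fun A hA => ⟨?_, ?_⟩⟩
  · refine (measure_mono ?_).trans ((h3 A hA).trans (ENNReal.ofReal_le_ofReal (min_le_left _ _)))
    rintro ω ⟨j, hj, hjd⟩ heq
    exact hj (heq ▸ hjd)
  · refine (measure_mono ?_).trans ((h3 A hA).trans (ENNReal.ofReal_le_ofReal (min_le_right _ _)))
    rintro ω ⟨k, hk, hkd⟩ heq
    exact hkd (heq ▸ hk)

end Gap

end StreamModel

-- Asymptotic equivalence and small error levels

section Asymptotics

variable {l : Filter (ℝ × ℝ)} {g : ℝ × ℝ → ℝ} {x y : ℝ × ℝ → ℝ≥0∞}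

theorem asympEq_ofReal_of_le_of_le (hg : Tendsto g l atTop) {lo hi : ℝ × ℝ → ℝ}
    (hlo : ∀ᶠ p in l, ENNReal.ofReal (lo p) ≤ x p) (hhi : ∀ᶠ p in l, x p ≤ ENNReal.ofReal (hi p))
    (hlo1 : Tendsto (fun p => lo p / g p) l (𝓝 1)) (hhi1 : Tendsto (fun p => hi p / g p) l (𝓝 1)) :
    AsympEq l x fun p => ENNReal.ofReal (g p) := by
  have h1 : Tendsto (fun p => ENNReal.ofReal (lo p / g p)) l (𝓝 1) := by
    simpa using ENNReal.tendsto_ofReal hlo1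
  have h2 : Tendsto (fun p => ENNReal.ofReal (hi p / g p)) l (𝓝 1) := by
    simpa using ENNReal.tendsto_ofReal hhi1
  refine tendsto_of_tendsto_of_tendsto_of_le_of_le' h1 h2 ?_ ?_
  · filter_upwards [hlo, hg.eventually_gt_atTop 0] with p hp hgp
    rw [ENNReal.ofReal_div_of_pos hgp]
    exact ENNReal.div_le_div_right hp _
  · filter_upwards [hhi, hg.eventually_gt_atTop 0] with p hp hgp
    rw [ENNReal.ofReal_div_of_pos hgp]
    exact ENNReal.div_le_div_right hp _

/-- Division in [0, ∞] cancels only factors that are neither 0 nor ∞; comparison with a real `g`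
tending to infinity supplies such a factor. -/
theorem AsympEq.of_ofReal (hg : Tendsto g l atTop) (hx : AsympEq l x fun p => ENNReal.ofReal (g p))
    (hy : AsympEq l y fun p => ENNReal.ofReal (g p)) : AsympEq l x y := by
  have h := ENNReal.Tendsto.div hx (Or.inl one_ne_zero) hy (Or.inl ENNReal.one_ne_top)
  rw [div_one] at h
  refine h.congr' ?_
  filter_upwards [hg.eventually_gt_atTop 0] with p hp
  have h0 : ENNReal.ofReal (g p) ≠ 0 := (ENNReal.ofReal_pos.2 hp).ne'
  rw [div_eq_mul_inv, div_eq_mul_inv, div_eq_mul_inv, div_eq_mul_inv,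
    ENNReal.mul_inv (Or.inr (ENNReal.inv_ne_top.2 h0)) (Or.inr (by simp)), inv_inv,
    mul_comm (y p)⁻¹, ← mul_assoc, mul_assoc (x p),
    ENNReal.inv_mul_cancel h0 ENNReal.ofReal_ne_top, mul_one]

theorem asympEq_ofReal_self (hg : Tendsto g l atTop) :
    AsympEq l (fun p => ENNReal.ofReal (g p)) fun p => ENNReal.ofReal (g p) := by
  refine tendsto_const_nhds.congr' ?_
  filter_upwards [hg.eventually_gt_atTop 0] with p hp
  exact (ENNReal.div_self (ENNReal.ofReal_pos.2 hp).ne' ENNReal.ofReal_ne_top).symm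

/-- Shows that the remainder in the upper bounds is of smaller order: √h / g = √(h / g) / √g tends
to 0. -/
theorem tendsto_add_sqrt_div (hg : Tendsto g l atTop) {h : ℝ × ℝ → ℝ}
    (hh : Tendsto (fun p => h p / g p) l (𝓝 1)) (C : ℝ) :
    Tendsto (fun p => (h p + C * √(h p) + C ^ 2) / g p) l (𝓝 1) := by
  have h1 : Tendsto (fun p => √(h p / g p) * (√(g p))⁻¹) l (𝓝 (√1 * 0)) :=
    (hh.sqrt).mul (tendsto_inv_atTop_zero.comp (Real.tendsto_sqrt_atTop.comp hg))
  have h2 : Tendsto (fun p => h p / g p + C * (√(h p / g p) * (√(g p))⁻¹) + C ^ 2 * (g p)⁻¹) l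
      (𝓝 (1 + C * (√1 * 0) + C ^ 2 * 0)) :=
    (hh.add (h1.const_mul C)).add ((tendsto_inv_atTop_zero.comp hg).const_mul _)
  simp only [mul_zero, add_zero] at h2
  refine h2.congr' ?_
  filter_upwards [hg.eventually_gt_atTop 0] with p hp
  have hs : √(h p / g p) * (√(g p))⁻¹ = √(h p) / g p := by
    rw [Real.sqrt_div' _ hp.le, ← div_eq_mul_inv, div_div, Real.mul_self_sqrt hp.le]
  rw [hs]
  field_simp

theorem tendsto_abs_log_fst : Tendsto (fun p : ℝ × ℝ => |Real.log p.1|) smallErrors atTop :=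
  (tendsto_abs_atBot_atTop.comp Real.tendsto_log_nhdsGT_zero).comp tendsto_fst

theorem tendsto_abs_log_snd : Tendsto (fun p : ℝ × ℝ => |Real.log p.2|) smallErrors atTop :=
  (tendsto_abs_atBot_atTop.comp Real.tendsto_log_nhdsGT_zero).comp tendsto_snd

theorem eventually_mem_Ioo_smallErrors :
    ∀ᶠ p : ℝ × ℝ in smallErrors, p.1 ∈ Set.Ioo (0 : ℝ) 1 ∧ p.2 ∈ Set.Ioo (0 : ℝ) 1 := by
  have h : ∀ᶠ x : ℝ in 𝓝[>] 0, x ∈ Set.Ioo (0 : ℝ) 1 := Ioo_mem_nhdsGT one_pos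
  exact h.prod_mk h

theorem tendsto_fst_smallErrors : Tendsto (fun p : ℝ × ℝ => p.1) smallErrors (𝓝 0) :=
  tendsto_fst.mono_right nhdsWithin_le_nhds

theorem tendsto_snd_smallErrors : Tendsto (fun p : ℝ × ℝ => p.2) smallErrors (𝓝 0) :=
  tendsto_snd.mono_right nhdsWithin_le_nhds

theorem abs_log_min {α β : ℝ} (hα : α ∈ Set.Ioo (0 : ℝ) 1) (hβ : β ∈ Set.Ioo (0 : ℝ) 1) :
    |Real.log (min α β)| = max |Real.log α| |Real.log β| := by
  rcases le_total α β with h | h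
  · rw [min_eq_left h, max_eq_left]
    rw [abs_of_neg (Real.log_neg hα.1 hα.2), abs_of_neg (Real.log_neg hβ.1 hβ.2)]
    exact neg_le_neg (Real.log_le_log hα.1 h)
  · rw [min_eq_right h, max_eq_right]
    rw [abs_of_neg (Real.log_neg hα.1 hα.2), abs_of_neg (Real.log_neg hβ.1 hβ.2)]
    exact neg_le_neg (Real.log_le_log hβ.1 h)

theorem abs_log_pos {α : ℝ} (hα : α ∈ Set.Ioo (0 : ℝ) 1) : 0 < |Real.log α| :=
  abs_pos.2 (Real.log_neg hα.1 hα.2).ne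

theorem mul_exp_neg_abs_log_add {α : ℝ} (hα : α ∈ Set.Ioo (0 : ℝ) 1) {n : ℝ} (hn : 0 < n) :
    n * Real.exp (-(|Real.log α| + Real.log n)) = α := by
  rw [abs_of_neg (Real.log_neg hα.1 hα.2), neg_add, neg_neg, Real.exp_add, Real.exp_log hα.1,
    Real.exp_neg, Real.exp_log hn]
  field_simp

end Asymptotics

-- First-order asymptotics without prior information

namespace StreamModel

variable {K : ℕ} (M : StreamModel.{u} K) {A : Finset (Fin K)}

theorem exists_secondMomentLE (M : StreamModel.{u} K) : ∃ V, 0 < V ∧ M.SecondMomentLE V := by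
  set m₀ : Fin K → ℝ := fun k => ∫ x, Real.log (M.f₀ k x / M.f₁ k x) ^ 2 * M.f₀ k x ∂(M.μ k)
  set m₁ : Fin K → ℝ := fun k => ∫ x, Real.log (M.f₀ k x / M.f₁ k x) ^ 2 * M.f₁ k x ∂(M.μ k)
  have h₀ : ∀ k, 0 ≤ m₀ k := fun k =>
    integral_nonneg fun x => mul_nonneg (sq_nonneg _) (M.nonneg₀ k x)
  have h₁ : ∀ k, 0 ≤ m₁ k := fun k =>
    integral_nonneg fun x => mul_nonneg (sq_nonneg _) (M.nonneg₁ k x)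
  have hs : ∀ k, m₀ k + m₁ k ≤ ∑ k, (m₀ k + m₁ k) := fun k =>
    Finset.single_le_sum (f := fun k => m₀ k + m₁ k) (fun k _ => add_nonneg (h₀ k) (h₁ k))
      (Finset.mem_univ k)
  have hs0 : 0 ≤ ∑ k, (m₀ k + m₁ k) := Finset.sum_nonneg fun k _ => add_nonneg (h₀ k) (h₁ k)
  refine ⟨1 + ∑ k, (m₀ k + m₁ k), by linarith, fun k => ⟨?_, ?_⟩⟩
  · change m₀ k ≤ _
    linarith [hs k, h₁ k]
  · change m₁ k ≤ _
    linarith [hs k, h₀ k]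

theorem exists_le_D (M : StreamModel.{u} K) (hK : 1 ≤ K) :
    ∃ δ, 0 < δ ∧ ∀ k, δ ≤ M.D₀ k ∧ δ ≤ M.D₁ k := by
  have : Nonempty (Fin K) := ⟨⟨0, hK⟩⟩
  obtain ⟨k, hk⟩ := Finite.exists_min fun k => min (M.D₀ k) (M.D₁ k)
  exact ⟨min (M.D₀ k) (M.D₁ k), lt_min (M.D₀_pos k) (M.D₁_pos k), fun j =>
    ⟨(hk j).trans (min_le_left _ _), (hk j).trans (min_le_right _ _)⟩⟩

theorem SecondMomentLE.mono {V V' : ℝ} (h : M.SecondMomentLE V) (hV : V ≤ V') :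
    M.SecondMomentLE V' := fun k => ⟨(h k).1.trans hV, (h k).2.trans hV⟩

theorem log_natCast_nonneg_of_one_le (hK : 1 ≤ K) : 0 ≤ Real.log K :=
  Real.log_nonneg (by exact_mod_cast hK)

theorem intersectionRule_mem_Δ (hK : 1 ≤ K) (hM : M.FiniteSecondMoment) {α β : ℝ}
    (hα : α ∈ Set.Ioo (0 : ℝ) 1) (hβ : β ∈ Set.Ioo (0 : ℝ) 1) (C : Set (Finset (Fin K))) :
    M.intersectionRule α β ∈ M.Δ α β C := by
  obtain ⟨V, hV, hsq⟩ := M.exists_secondMomentLE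
  obtain ⟨δ, hδ, hD⟩ := M.exists_le_D hK
  have hlogK := log_natCast_nonneg_of_one_le hK
  have hK0 : (0 : ℝ) < K := by exact_mod_cast hK
  have hα0 := abs_log_pos hα
  have hβ0 := abs_log_pos hβ
  set a := |Real.log β| + Real.log K with ha
  set b := |Real.log α| + Real.log K with hb
  have ha0 : 0 < a := by linarith
  have hb0 : 0 < b := by linarith
  refine M.intersection_mem_Δ ha0 hb0 (mul_exp_neg_abs_log_add hβ hK0).le
    (mul_exp_neg_abs_log_add hα hK0).le (fun A => ?_) C
  -- The crude choice H = (a + b) / δ suffices, as only finiteness of the mean, and thus almost sure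
  -- stopping, is needed.
  have key : ∀ D, δ ≤ D → a + b ≤ (a + b) / δ * D := fun D h => by
    rw [div_mul_eq_mul_div, le_div_iff₀ hδ]
    exact mul_le_mul_of_nonneg_left h (by linarith)
  refine RandomWalk.measure_eq_top_eq_zero
    (M.isStoppingTime_firstTime (measurableSet_outside a b)) (ne_top_of_le_ne_top
    ENNReal.ofReal_ne_top (M.ess_intersectionTime_le (A := A) (H := (a + b) / δ) hK hM hV hsq hδ hD
      ha0 hb0 (fun k _ => ?_) fun k _ => ?_))
  · linarith [key _ (hD k).2]
  · linarith [key _ (hD k).1]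

/-- The summand log K in both thresholds lengthens the time scale `G` by at most log K / δ. -/
theorem ess_intersectionRule_le (hK : 1 ≤ K) (hM : M.FiniteSecondMoment) {V δ G α β : ℝ}
    (hV : 0 < V) (hsq : M.SecondMomentLE V) (hδ : 0 < δ) (hD : ∀ k, δ ≤ M.D₀ k ∧ δ ≤ M.D₁ k)
    (hα : α ∈ Set.Ioo (0 : ℝ) 1) (hβ : β ∈ Set.Ioo (0 : ℝ) 1)
    (h1 : ∀ k ∈ A, |Real.log α| ≤ G * M.D₁ k) (h0 : ∀ k ∉ A, |Real.log β| ≤ G * M.D₀ k) :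
    M.ess A (M.intersectionRule α β).1 ≤
      ENNReal.ofReal (G + Real.log K / δ + (K * (2 * √V / δ)) * √(G + Real.log K / δ) +
        (K * (2 * √V / δ)) ^ 2) := by
  have hlogK := log_natCast_nonneg_of_one_le hK
  have hα0 := abs_log_pos hα
  have hβ0 := abs_log_pos hβ
  have key : ∀ D, δ ≤ D → Real.log K ≤ Real.log K / δ * D := fun D h => by
    rw [div_mul_eq_mul_div, le_div_iff₀ hδ]
    exact mul_le_mul_of_nonneg_left h hlogK
  refine M.ess_intersectionTime_le hK hM hV hsq hδ hD (by linarith) (by linarith)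
    (fun k hk => ?_) fun k hk => ?_
  · rw [add_mul]
    exact add_le_add (h1 k hk) (key _ (hD k).2)
  · rw [add_mul]
    exact add_le_add (h0 k hk) (key _ (hD k).1)

theorem ofReal_div_iInf_eq {ι : Type*} [Finite ι] (s : ι → Prop) {D : ι → ℝ} (hD : ∀ k, 0 < D k)
    (x : ℝ) :
    ((∀ k, ¬s k) ∧ ENNReal.ofReal x / (⨅ (k) (_ : s k), ENNReal.ofReal (D k)) = 0) ∨
    ∃ k, s k ∧ (∀ j, s j → D k ≤ D j) ∧
      ENNReal.ofReal x / (⨅ (k) (_ : s k), ENNReal.ofReal (D k)) = ENNReal.ofReal (x / D k) := by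
  by_cases h : ∃ k, s k
  · right
    obtain ⟨k, hk, hmin⟩ := Set.exists_min_image {k | s k} D (Set.toFinite _) h
    refine ⟨k, hk, hmin, ?_⟩
    have : (⨅ (k) (_ : s k), ENNReal.ofReal (D k)) = ENNReal.ofReal (D k) :=
      le_antisymm (iInf₂_le k hk) (le_iInf₂ fun j hj => ENNReal.ofReal_le_ofReal (hmin j hj))
    rw [this, ENNReal.ofReal_div_of_pos (hD k)]
  · left
    push Not at h
    refine ⟨h, ?_⟩
    have : (⨅ (k) (_ : s k), ENNReal.ofReal (D k)) = ⊤ := by simp [h]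
    rw [this, ENNReal.div_top]

/-- Real-valued form of the benchmark. Its domination over all streams feeds the upper bounds; a
stream that attains it, which exists because K ≥ 1, feeds the lower bounds. -/
theorem firstOrder_spec (hK : 1 ≤ K) (A : Finset (Fin K)) (α β : ℝ) :
    M.firstOrder A α β = ENNReal.ofReal (M.firstOrder A α β).toReal ∧
    (∀ k ∈ A, |Real.log α| ≤ (M.firstOrder A α β).toReal * M.D₁ k) ∧
    (∀ k ∉ A, |Real.log β| ≤ (M.firstOrder A α β).toReal * M.D₀ k) ∧
    ((∃ k ∈ A, (M.firstOrder A α β).toReal = |Real.log α| / M.D₁ k) ∨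
      ∃ k ∉ A, (M.firstOrder A α β).toReal = |Real.log β| / M.D₀ k) := by
  have hx := abs_nonneg (Real.log α)
  have hy := abs_nonneg (Real.log β)
  have hle : ∀ {x D g : ℝ}, 0 < D → x / D ≤ g → x ≤ g * D := fun hD h => (div_le_iff₀ hD).1 h
  have e1 := ofReal_div_iInf_eq (fun k => k ∈ A) M.D₁_pos |Real.log α|
  have e0 := ofReal_div_iInf_eq (fun k => k ∉ A) M.D₀_pos |Real.log β|
  have mono : ∀ {x D D' : ℝ}, 0 ≤ x → 0 < D → D ≤ D' → x / D' ≤ x / D := fun hx hD h =>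
    div_le_div_of_nonneg_left hx hD h
  unfold firstOrder η₁ η₀
  rcases e1 with ⟨hA, e1⟩ | ⟨k, hk, hkm, e1⟩
  · rcases e0 with ⟨hA', -⟩ | ⟨j, hj, hjm, e0⟩
    · exact absurd (hA ⟨0, hK⟩) (hA' ⟨0, hK⟩)
    · have hj0 : 0 ≤ |Real.log β| / M.D₀ j := div_nonneg hy (M.D₀_pos j).le
      rw [e1, e0, max_eq_right zero_le, ENNReal.toReal_ofReal hj0]
      exact ⟨rfl, fun i hi => absurd hi (hA i),
        fun i hi => hle (M.D₀_pos i) (mono hy (M.D₀_pos j) (hjm i hi)), Or.inr ⟨j, hj, rfl⟩⟩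
  · have hk0 : 0 ≤ |Real.log α| / M.D₁ k := div_nonneg hx (M.D₁_pos k).le
    rcases e0 with ⟨hA', e0⟩ | ⟨j, hj, hjm, e0⟩
    · rw [e1, e0, max_eq_left zero_le, ENNReal.toReal_ofReal hk0]
      exact ⟨rfl, fun i hi => hle (M.D₁_pos i) (mono hx (M.D₁_pos k) (hkm i hi)),
        fun i hi => absurd hi (hA' i), Or.inl ⟨k, hk, rfl⟩⟩
    · have hj0 : 0 ≤ |Real.log β| / M.D₀ j := div_nonneg hy (M.D₀_pos j).le
      rw [e1, e0, ← ENNReal.ofReal_max, ENNReal.toReal_ofReal (le_max_of_le_left hk0)]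
      refine ⟨rfl, fun i hi => hle (M.D₁_pos i) ?_, fun i hi => hle (M.D₀_pos i) ?_, ?_⟩
      · exact (mono hx (M.D₁_pos k) (hkm i hi)).trans (le_max_left _ _)
      · exact (mono hy (M.D₀_pos j) (hjm i hi)).trans (le_max_right _ _)
      · rcases max_choice (|Real.log α| / M.D₁ k) (|Real.log β| / M.D₀ j) with h | h
        · exact Or.inl ⟨k, hk, h⟩
        · exact Or.inr ⟨j, hj, h⟩

/-- The upper bound for the expected sample size of the intersection rule. -/
theorem eventually_ess_intersectionRule_le (hK : 1 ≤ K) (hM : M.FiniteSecondMoment) {V δ : ℝ}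
    (hV : 0 < V) (hsq : M.SecondMomentLE V) (hδ : 0 < δ) (hD : ∀ k, δ ≤ M.D₀ k ∧ δ ≤ M.D₁ k)
    (A : Finset (Fin K)) :
    ∀ᶠ p : ℝ × ℝ in smallErrors, M.ess A (M.intersectionRule p.1 p.2).1 ≤
      M.firstOrder A p.1 p.2 + ENNReal.ofReal
        ((2 * √V / δ * √(2 / δ) + 1) * (K * √|Real.log (min p.1 p.2)|)) := by
  have hlogK := log_natCast_nonneg_of_one_le hK
  have hK1 : (1 : ℝ) ≤ K := by exact_mod_cast hK
  set C := K * (2 * √V / δ) with hC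
  -- How small the errors must be may depend on K. This lets √L absorb log K / δ + C², which
  -- accounts for the `+ 1` in the constant; the factor √(2 / δ) comes from g + log K / δ ≤ 2L / δ.
  filter_upwards [eventually_mem_Ioo_smallErrors,
    tendsto_abs_log_fst.eventually_ge_atTop (Real.log K),
    (Real.tendsto_sqrt_atTop.comp tendsto_abs_log_fst).eventually_ge_atTop
      (Real.log K / δ + C ^ 2)] with p hp hp1 hp2
  obtain ⟨e, h1, h0, hatt⟩ := M.firstOrder_spec hK A p.1 p.2
  refine (M.ess_intersectionRule_le hK hM hV hsq hδ hD hp.1 hp.2 h1 h0).trans ?_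
  rw [e, ENNReal.toReal_ofReal ENNReal.toReal_nonneg]
  set g := (M.firstOrder A p.1 p.2).toReal with hg
  have hg0 : 0 ≤ g := ENNReal.toReal_nonneg
  set L := |Real.log (min p.1 p.2)| with hL
  have hLmax : L = max |Real.log p.1| |Real.log p.2| := abs_log_min hp.1 hp.2
  have hL1 : |Real.log p.1| ≤ L := hLmax ▸ le_max_left _ _
  have hL2 : |Real.log p.2| ≤ L := hLmax ▸ le_max_right _ _
  have hgL : g ≤ L / δ := by
    rcases hatt with ⟨k, _, h⟩ | ⟨k, _, h⟩
    · rw [h]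
      exact div_le_div₀ (abs_nonneg _) hL1 hδ (hD k).2
    · rw [h]
      exact div_le_div₀ (abs_nonneg _) hL2 hδ (hD k).1
  have hH : g + Real.log K / δ ≤ 2 / δ * L := by
    have : Real.log K / δ ≤ L / δ := div_le_div_of_nonneg_right (hp1.trans hL1) hδ.le
    calc _ ≤ L / δ + L / δ := add_le_add hgL this
      _ = _ := by ring
  have hsqrt : √(g + Real.log K / δ) ≤ √(2 / δ) * √L := by
    rw [← Real.sqrt_mul (by positivity)]
    exact Real.sqrt_le_sqrt hH
  have hC0 : 0 ≤ C := by positivity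
  have hrest : Real.log K / δ + C ^ 2 ≤ K * √L := by
    have h2 : Real.log K / δ + C ^ 2 ≤ √L := le_trans hp2 (Real.sqrt_le_sqrt hL1)
    nlinarith [Real.sqrt_nonneg L]
  rw [← ENNReal.ofReal_add hg0 (by positivity)]
  refine ENNReal.ofReal_le_ofReal ?_
  have h3 := mul_le_mul_of_nonneg_left hsqrt hC0
  have h4 : (2 * √V / δ * √(2 / δ) + 1) * (K * √L) = C * (√(2 / δ) * √L) + K * √L := by
    rw [hC]; ring
  rw [h4]
  linarith

theorem tendsto_firstOrder (hK : 1 ≤ K) (A : Finset (Fin K)) :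
    Tendsto (fun p : ℝ × ℝ => (M.firstOrder A p.1 p.2).toReal) smallErrors atTop := by
  by_cases h : (⟨0, hK⟩ : Fin K) ∈ A
  · refine tendsto_atTop_mono (fun p => ?_)
      (tendsto_abs_log_fst.atTop_div_const (M.D₁_pos ⟨0, hK⟩))
    rw [div_le_iff₀ (M.D₁_pos _)]
    exact (M.firstOrder_spec hK A p.1 p.2).2.1 _ h
  · refine tendsto_atTop_mono (fun p => ?_)
      (tendsto_abs_log_snd.atTop_div_const (M.D₀_pos ⟨0, hK⟩))
    rw [div_le_iff₀ (M.D₀_pos _)]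
    exact (M.firstOrder_spec hK A p.1 p.2).2.2.1 _ h

theorem mem_classBetween_zero (A : Finset (Fin K)) : A ∈ classBetween K 0 K :=
  ⟨Nat.zero_le _, by simpa using A.card_le_univ⟩

theorem optimalESS_le_of_mem {A : Finset (Fin K)}
    {S : Set ((M.Ω → WithTop ℕ) × (M.Ω → Finset (Fin K)))}
    {t : (M.Ω → WithTop ℕ) × (M.Ω → Finset (Fin K))} (ht : t ∈ S) :
    M.optimalESS A S ≤ M.ess A t.1 := iInf₂_le t ht

/-- A stream attaining the maximum selects the neighbour: dropped if it is a signal, added if it is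
noise. The full class contains both. Using α + β and 1 / δ makes the two cases uniform. -/
theorem firstOrder_lower_bound (hK : 1 ≤ K) {δ : ℝ} (hδ : 0 < δ)
    (hD : ∀ k, δ ≤ M.D₀ k ∧ δ ≤ M.D₁ k) {α β : ℝ} (hα : α ∈ Set.Ioo (0 : ℝ) 1)
    (hβ : β ∈ Set.Ioo (0 : ℝ) 1) (A : Finset (Fin K)) :
    ENNReal.ofReal ((1 - (α + β)) * (M.firstOrder A α β).toReal - 1 / δ) ≤
      M.optimalESS A (M.Δ α β (classBetween K 0 K)) := by
  have hg0 : 0 ≤ (M.firstOrder A α β).toReal := ENNReal.toReal_nonneg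
  rcases (M.firstOrder_spec hK A α β).2.2.2 with ⟨k, hk, h⟩ | ⟨k, hk, h⟩
  · refine le_trans (ENNReal.ofReal_le_ofReal ?_)
      (M.le_optimalESS_erase hα hβ (mem_classBetween_zero A) hk (mem_classBetween_zero _))
    have h1 : 1 / M.D₁ k ≤ 1 / δ := one_div_le_one_div_of_le hδ (hD k).2
    rw [sub_div, mul_div_assoc, ← h]
    nlinarith [mul_nonneg hα.1.le hg0]
  · refine le_trans (ENNReal.ofReal_le_ofReal ?_)
      (M.le_optimalESS_insert hα hβ (mem_classBetween_zero A) hk (mem_classBetween_zero _))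
    have h1 : 1 / M.D₀ k ≤ 1 / δ := one_div_le_one_div_of_le hδ (hD k).1
    rw [sub_div, mul_div_assoc, ← h]
    nlinarith [mul_nonneg hβ.1.le hg0]

theorem tendsto_one_sub_mul_sub_div {l : Filter (ℝ × ℝ)} (hl : l ≤ smallErrors) {g h : ℝ × ℝ → ℝ}
    (hg : Tendsto g l atTop) (hh : Tendsto (fun p => h p / g p) l (𝓝 1)) (c : ℝ) :
    Tendsto (fun p => ((1 - (p.1 + p.2)) * h p - c) / g p) l (𝓝 1) := by
  have h1 : Tendsto (fun p : ℝ × ℝ => (1 - (p.1 + p.2)) * (h p / g p) - c * (g p)⁻¹) l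
      (𝓝 ((1 - (0 + 0)) * 1 - c * 0)) :=
    ((((tendsto_fst_smallErrors.mono_left hl).add
      (tendsto_snd_smallErrors.mono_left hl)).const_sub 1).mul hh).sub
      ((tendsto_inv_atTop_zero.comp hg).const_mul c)
  simp only [add_zero, sub_zero, mul_one, mul_zero] at h1
  refine h1.congr fun p => ?_
  rw [sub_div, mul_div_assoc, div_eq_mul_inv c]

/-- Without prior information, both the intersection rule and the optimal expected sample size are
of the order of the first-order bound. -/
theorem asympEq_firstOrder (hK : 1 ≤ K) (hM : M.FiniteSecondMoment) (A : Finset (Fin K)) :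
    (AsympEq smallErrors (fun p => M.ess A (M.intersectionRule p.1 p.2).1)
      fun p => ENNReal.ofReal (M.firstOrder A p.1 p.2).toReal) ∧
    AsympEq smallErrors (fun p => M.optimalESS A (M.Δ p.1 p.2 (classBetween K 0 K)))
      fun p => ENNReal.ofReal (M.firstOrder A p.1 p.2).toReal := by
  obtain ⟨V, hV, hsq⟩ := M.exists_secondMomentLE
  obtain ⟨δ, hδ, hD⟩ := M.exists_le_D hK
  have hg := M.tendsto_firstOrder hK A
  set g : ℝ × ℝ → ℝ := fun p => (M.firstOrder A p.1 p.2).toReal with hgdef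
  have hgg : Tendsto (fun p => g p / g p) smallErrors (𝓝 1) := by
    refine tendsto_const_nhds.congr' ?_
    filter_upwards [hg.eventually_gt_atTop 0] with p hp
    exact (div_self hp.ne').symm
  have hh : Tendsto (fun p => (g p + Real.log K / δ) / g p) smallErrors (𝓝 1) := by
    have := hgg.add ((tendsto_inv_atTop_zero.comp hg).const_mul (Real.log K / δ))
    simp only [mul_zero, add_zero] at this
    refine this.congr fun p => ?_
    rw [add_div, div_eq_mul_inv (Real.log K / δ)]
    rfl
  have hlo := tendsto_one_sub_mul_sub_div le_rfl hg hgg (1 / δ)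
  have hhi := tendsto_add_sqrt_div hg hh (K * (2 * √V / δ))
  have h1 : ∀ᶠ p : ℝ × ℝ in smallErrors, ENNReal.ofReal ((1 - (p.1 + p.2)) * g p - 1 / δ) ≤
      M.optimalESS A (M.Δ p.1 p.2 (classBetween K 0 K)) := by
    filter_upwards [eventually_mem_Ioo_smallErrors] with p hp
    exact M.firstOrder_lower_bound hK hδ hD hp.1 hp.2 A
  have h2 : ∀ᶠ p : ℝ × ℝ in smallErrors, M.optimalESS A (M.Δ p.1 p.2 (classBetween K 0 K)) ≤
      M.ess A (M.intersectionRule p.1 p.2).1 := by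
    filter_upwards [eventually_mem_Ioo_smallErrors] with p hp
    exact M.optimalESS_le_of_mem (M.intersectionRule_mem_Δ hK hM hp.1 hp.2 _)
  have h3 : ∀ᶠ p : ℝ × ℝ in smallErrors, M.ess A (M.intersectionRule p.1 p.2).1 ≤
      ENNReal.ofReal (g p + Real.log K / δ + (K * (2 * √V / δ)) * √(g p + Real.log K / δ) +
        (K * (2 * √V / δ)) ^ 2) := by
    filter_upwards [eventually_mem_Ioo_smallErrors] with p hp
    obtain ⟨-, h1, h0, -⟩ := M.firstOrder_spec hK A p.1 p.2
    exact M.ess_intersectionRule_le hK hM hV hsq hδ hD hp.1 hp.2 h1 h0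
  constructor
  · refine asympEq_ofReal_of_le_of_le hg ?_ h3 hlo hhi
    filter_upwards [h1, h2] with p hp1 hp2 using hp1.trans hp2
  · refine asympEq_ofReal_of_le_of_le hg h1 ?_ hlo hhi
    filter_upwards [h2, h3] with p hp2 hp3 using hp2.trans hp3

end StreamModel

-- Logarithms of comparable error levels

section Ratio

variable {l : Filter (ℝ × ℝ)}

theorem tendsto_abs_log_snd_div
    (hr : Tendsto (fun p => |Real.log p.1| / |Real.log p.2|) l (𝓝 1)) :
    Tendsto (fun p : ℝ × ℝ => |Real.log p.2| / |Real.log p.1|) l (𝓝 1) := by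
  have := hr.inv₀ one_ne_zero
  rw [inv_one] at this
  exact this.congr fun p => inv_div _ _

theorem tendsto_abs_log_fst_div_self (hl : l ≤ smallErrors) :
    Tendsto (fun p : ℝ × ℝ => |Real.log p.1| / |Real.log p.1|) l (𝓝 1) := by
  refine tendsto_const_nhds.congr' ?_
  filter_upwards [(tendsto_abs_log_fst.mono_left hl).eventually_gt_atTop 0] with p hp
  exact (div_self hp.ne').symm

theorem tendsto_max_add_div (hl : l ≤ smallErrors)
    (hr : Tendsto (fun p => |Real.log p.1| / |Real.log p.2|) l (𝓝 1)) (c : ℝ) {D : ℝ}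
    (hD : 0 < D) : Tendsto (fun p : ℝ × ℝ =>
      ((max |Real.log p.1| |Real.log p.2| + c) / D) / (|Real.log p.1| / D)) l (𝓝 1) := by
  have h1 := ((tendsto_abs_log_fst_div_self hl).max (tendsto_abs_log_snd_div hr)).add
    ((tendsto_inv_atTop_zero.comp (tendsto_abs_log_fst.mono_left hl)).const_mul c)
  simp only [max_self, mul_zero, add_zero] at h1
  refine h1.congr fun p => ?_
  rw [div_div_div_cancel_right₀ hD.ne', add_div, max_div_div_right (abs_nonneg _),
    div_eq_mul_inv c]
  rfl

theorem tendsto_min_div (hl : l ≤ smallErrors)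
    (hr : Tendsto (fun p => |Real.log p.1| / |Real.log p.2|) l (𝓝 1)) {D : ℝ} (hD : 0 < D) :
    Tendsto (fun p : ℝ × ℝ =>
      (min |Real.log p.1| |Real.log p.2| / D) / (|Real.log p.1| / D)) l (𝓝 1) := by
  have h1 := (tendsto_abs_log_fst_div_self hl).min (tendsto_abs_log_snd_div hr)
  simp only [min_self] at h1
  refine h1.congr fun p => ?_
  rw [div_div_div_cancel_right₀ hD.ne', min_div_div_right (abs_nonneg _)]

end Ratio

-- The symmetric case

namespace StreamModel

variable {K : ℕ} (M : StreamModel.{u} K) {A : Finset (Fin K)}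

/-- Since ℓ < u, from `A` one can drop or add a stream within the class, but perhaps only one of the
two. Which error level governs thus depends on |A|, hence the minimum. -/
theorem symmetric_lower_bound {D : ℝ} (hD0 : 0 < D) (hD : ∀ k, M.D₀ k = D ∧ M.D₁ k = D) {ℓ u : ℕ}
    (hlu : ℓ < u) (hu : u ≤ K) (hA : A ∈ classBetween K ℓ u) {α β : ℝ}
    (hα : α ∈ Set.Ioo (0 : ℝ) 1) (hβ : β ∈ Set.Ioo (0 : ℝ) 1) :
    ENNReal.ofReal ((1 - (α + β)) * (min |Real.log α| |Real.log β| / D) - 1 / D) ≤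
      M.optimalESS A (M.Δ α β (classBetween K ℓ u)) := by
  obtain ⟨hA1, hA2⟩ := id hA
  have hmin0 : 0 ≤ min |Real.log α| |Real.log β| := le_min (abs_nonneg _) (abs_nonneg _)
  have hm1 := min_le_left |Real.log α| |Real.log β|
  have hm2 := min_le_right |Real.log α| |Real.log β|
  rw [← mul_div_assoc, ← sub_div]
  by_cases h : ℓ < A.card
  · obtain ⟨k, hk⟩ := Finset.card_pos.1 (by omega : 0 < A.card)
    have hc := Finset.card_erase_of_mem hk
    refine le_trans (ENNReal.ofReal_le_ofReal ?_)
      (M.le_optimalESS_erase hα hβ hA hk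
        (show A.erase k ∈ classBetween K ℓ u from ⟨by omega, by omega⟩))
    rw [(hD k).2]
    refine div_le_div_of_nonneg_right ?_ hD0.le
    nlinarith [hα.1, hβ.2]
  · obtain ⟨j, hj⟩ : ∃ j, j ∉ A := by
      by_contra hcon
      push Not at hcon
      have : A.card = K := by rw [Finset.eq_univ_of_forall hcon, Finset.card_fin]
      omega
    have hc := Finset.card_insert_of_notMem hj
    refine le_trans (ENNReal.ofReal_le_ofReal ?_)
      (M.le_optimalESS_insert hα hβ hA hj
        (show insert j A ∈ classBetween K ℓ u from ⟨by omega, by omega⟩))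
    rw [(hD j).1]
    refine div_le_div_of_nonneg_right ?_ hD0.le
    nlinarith [hβ.1, hα.2]

theorem symmetric_upper_bound (hK : 1 ≤ K) (hM : M.FiniteSecondMoment) {V D : ℝ}
    (hV : 0 < V) (hsq : M.SecondMomentLE V) (hD0 : 0 < D) (hD : ∀ k, M.D₀ k = D ∧ M.D₁ k = D)
    (A : Finset (Fin K)) {α β : ℝ} (hα : α ∈ Set.Ioo (0 : ℝ) 1) (hβ : β ∈ Set.Ioo (0 : ℝ) 1) :
    M.ess A (M.intersectionRule α β).1 ≤
      ENNReal.ofReal ((max |Real.log α| |Real.log β| + Real.log K) / D +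
        (K * (2 * √V / D)) * √((max |Real.log α| |Real.log β| + Real.log K) / D) +
        (K * (2 * √V / D)) ^ 2) := by
  rw [add_div]
  refine M.ess_intersectionRule_le hK hM hV hsq hD0 (fun k => ⟨(hD k).1.ge, (hD k).2.ge⟩) hα hβ
    (fun k _ => ?_) fun k _ => ?_
  · rw [(hD k).2, div_mul_cancel₀ _ hD0.ne']
    exact le_max_left _ _
  · rw [(hD k).1, div_mul_cancel₀ _ hD0.ne']
    exact le_max_right _ _

/-- The symmetric case with at least `ℓ` and at most `u` signals. -/
theorem asympEq_symmetric (hK : 1 ≤ K) (hM : M.FiniteSecondMoment) {D : ℝ} (hD0 : 0 < D)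
    (hD : ∀ k, M.D₀ k = D ∧ M.D₁ k = D) {l : Filter (ℝ × ℝ)} (hl : l ≤ smallErrors)
    (hr : Tendsto (fun p => |Real.log p.1| / |Real.log p.2|) l (𝓝 1)) {ℓ u : ℕ} (hlu : ℓ < u)
    (hu : u ≤ K) (hA : A ∈ classBetween K ℓ u) :
    (AsympEq l (fun p => M.ess A (M.intersectionRule p.1 p.2).1)
      fun p => ENNReal.ofReal (|Real.log p.1| / D)) ∧
    AsympEq l (fun p => M.optimalESS A (M.Δ p.1 p.2 (classBetween K ℓ u)))
      fun p => ENNReal.ofReal (|Real.log p.1| / D) := by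
  obtain ⟨V, hV, hsq⟩ := M.exists_secondMomentLE
  have hg : Tendsto (fun p : ℝ × ℝ => |Real.log p.1| / D) l atTop :=
    (tendsto_abs_log_fst.mono_left hl).atTop_div_const hD0
  have hlo := tendsto_one_sub_mul_sub_div hl hg (tendsto_min_div hl hr hD0) (1 / D)
  have hhi := tendsto_add_sqrt_div hg (tendsto_max_add_div hl hr (Real.log K) hD0)
    (K * (2 * √V / D))
  have hmem := eventually_mem_Ioo_smallErrors.filter_mono hl
  have h1 : ∀ᶠ p : ℝ × ℝ in l, ENNReal.ofReal
      ((1 - (p.1 + p.2)) * (min |Real.log p.1| |Real.log p.2| / D) - 1 / D) ≤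
      M.optimalESS A (M.Δ p.1 p.2 (classBetween K ℓ u)) := by
    filter_upwards [hmem] with p hp
    exact M.symmetric_lower_bound hD0 hD hlu hu hA hp.1 hp.2
  have h2 : ∀ᶠ p : ℝ × ℝ in l, M.optimalESS A (M.Δ p.1 p.2 (classBetween K ℓ u)) ≤
      M.ess A (M.intersectionRule p.1 p.2).1 := by
    filter_upwards [hmem] with p hp
    exact M.optimalESS_le_of_mem (M.intersectionRule_mem_Δ hK hM hp.1 hp.2 _)
  have h3 : ∀ᶠ p : ℝ × ℝ in l, M.ess A (M.intersectionRule p.1 p.2).1 ≤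
      ENNReal.ofReal ((max |Real.log p.1| |Real.log p.2| + Real.log K) / D +
        (K * (2 * √V / D)) * √((max |Real.log p.1| |Real.log p.2| + Real.log K) / D) +
        (K * (2 * √V / D)) ^ 2) := by
    filter_upwards [hmem] with p hp
    exact M.symmetric_upper_bound hK hM hV hsq hD0 hD A hp.1 hp.2
  constructor
  · refine asympEq_ofReal_of_le_of_le hg ?_ h3 hlo hhi
    filter_upwards [h1, h2] with p hp1 hp2 using hp1.trans hp2
  · refine asympEq_ofReal_of_le_of_le hg h1 ?_ hlo hhi
    filter_upwards [h2, h3] with p hp2 hp3 using hp2.trans hp3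

theorem nonempty_signalNoisePair {m : ℕ} (hm1 : 1 ≤ m) (hmK : m ≤ K - 1) (hA : A.card = m) :
    Nonempty (SignalNoisePair A) := by
  obtain ⟨k, hk⟩ := Finset.card_pos.1 (by omega : 0 < A.card)
  obtain ⟨j, hj⟩ : ∃ j, j ∉ A := by
    by_contra hcon
    push Not at hcon
    have : A.card = K := by rw [Finset.eq_univ_of_forall hcon, Finset.card_fin]
    omega
  exact ⟨⟨(k, j), hk, hj⟩⟩

theorem exactly_lower_bound {D : ℝ} (hD0 : 0 < D) (hD : ∀ k, M.D₀ k = D ∧ M.D₁ k = D) {m : ℕ}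
    (hm1 : 1 ≤ m) (hmK : m ≤ K - 1) (hA : A ∈ classExactly K m) {α β : ℝ}
    (hα : α ∈ Set.Ioo (0 : ℝ) 1) (hβ : β ∈ Set.Ioo (0 : ℝ) 1) :
    ENNReal.ofReal ((1 - (α + β)) * (min |Real.log α| |Real.log β| / D) - 1 / D) ≤
      2 * M.optimalESS A (M.Δ α β (classExactly K m)) := by
  have hAm : A.card = m := hA
  obtain ⟨⟨⟨k, j⟩, hk, hj⟩⟩ := nonempty_signalNoisePair hm1 hmK hAm
  have hc : insert j (A.erase k) ∈ classExactly K m := by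
    change (insert j (A.erase k)).card = m
    rw [Finset.card_insert_of_notMem fun h => hj (Finset.mem_of_mem_erase h),
      Finset.card_erase_of_mem hk]
    omega
  have hmin0 : 0 ≤ min |Real.log α| |Real.log β| := le_min (abs_nonneg _) (abs_nonneg _)
  have hm2 := min_le_right |Real.log α| |Real.log β|
  have hle : (1 - (α + β)) * (min |Real.log α| |Real.log β| / D) - 1 / D ≤
      2 * (((1 - α) * |Real.log β| - 1) / (M.D₁ k + M.D₀ j)) := by
    rw [(hD k).2, (hD j).1, ← mul_div_assoc, ← sub_div]
    have : 2 * (((1 - α) * |Real.log β| - 1) / (D + D)) = ((1 - α) * |Real.log β| - 1) / D := by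
      field_simp
      ring
    rw [this]
    refine div_le_div_of_nonneg_right ?_ hD0.le
    nlinarith [hβ.1, hα.2]
  refine (ENNReal.ofReal_le_ofReal hle).trans ?_
  rw [ENNReal.ofReal_mul zero_le_two, ENNReal.ofReal_ofNat]
  exact mul_le_mul_right (M.le_optimalESS_swap hα hβ hA hj hk hc) _

theorem exactly_upper_bound (hM : M.FiniteSecondMoment) {V D : ℝ} (hV : 0 < V)
    (hsq : M.SecondMomentLE V) (hD0 : 0 < D) (hD : ∀ k, M.D₀ k = D ∧ M.D₁ k = D) {m : ℕ}
    (hm1 : 1 ≤ m) (hmK : m ≤ K - 1) (hA : A ∈ classExactly K m) {α β : ℝ}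
    (hα : α ∈ Set.Ioo (0 : ℝ) 1) (hβ : β ∈ Set.Ioo (0 : ℝ) 1) :
    M.optimalESS A (M.ΔExactly α β m) ≤ ENNReal.ofReal
      ((max |Real.log α| |Real.log β| + Real.log (m * (K - m) : ℕ)) / (2 * D) +
        (Fintype.card (SignalNoisePair A) * (2 * √(4 * V) / (2 * D))) *
          √((max |Real.log α| |Real.log β| + Real.log (m * (K - m) : ℕ)) / (2 * D)) +
        (Fintype.card (SignalNoisePair A) * (2 * √(4 * V) / (2 * D))) ^ 2) := by
  have hAm : A.card = m := hA
  have hpos : 0 < m * (K - m) := Nat.mul_pos (by omega) (by omega)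
  have hpos' : (0 : ℝ) < (m * (K - m) : ℕ) := by exact_mod_cast hpos
  have hlog : 0 ≤ Real.log (m * (K - m) : ℕ) := Real.log_nonneg (by exact_mod_cast hpos)
  have hmin : min α β ∈ Set.Ioo (0 : ℝ) 1 :=
    ⟨lt_min hα.1 hβ.1, (min_le_left _ _).trans_lt hα.2⟩
  have hL := abs_log_pos hmin
  rw [← abs_log_min hα hβ]
  -- There are m(K - m) possible exchanges, and this gap makes their union bound exactly α ∧ β.
  set c := |Real.log (min α β)| + Real.log (m * (K - m) : ℕ) with hc
  have hc0 : 0 < c := by linarith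
  -- Needed under every `B` of the class, not only `A`: error control requires almost sure stopping
  -- under each. The set `A` serves as the decision when the rule never stops.
  have hess : ∀ B ∈ classExactly K m, M.ess B (M.gapRule m c A).1 ≤ _ := fun B hB =>
    have := nonempty_signalNoisePair hm1 hmK hB
    M.ess_gapRule_le hM hV hsq hD0 hD hc0 hB A
  refine (M.optimalESS_le_of_mem (M.gapRule_mem_ΔExactly hc0
    (mul_exp_neg_abs_log_add hmin hpos').le hAm fun B hB => ?_)).trans (hess A hA)
  exact RandomWalk.measure_eq_top_eq_zero
    (M.isStoppingTime_firstTime (measurableSet_gapSet m c))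
    (ne_top_of_le_ne_top ENNReal.ofReal_ne_top (hess B hB))

/-- The symmetric case with exactly `m` signals. -/
theorem asympEq_exactly (hM : M.FiniteSecondMoment) {D : ℝ} (hD0 : 0 < D)
    (hD : ∀ k, M.D₀ k = D ∧ M.D₁ k = D) {l : Filter (ℝ × ℝ)} (hl : l ≤ smallErrors)
    (hr : Tendsto (fun p => |Real.log p.1| / |Real.log p.2|) l (𝓝 1)) {m : ℕ} (hm1 : 1 ≤ m)
    (hmK : m ≤ K - 1) (hA : A ∈ classExactly K m) :
    (AsympEq l (fun p => 2 * M.optimalESS A (M.Δ p.1 p.2 (classExactly K m)))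
      fun p => ENNReal.ofReal (|Real.log p.1| / D)) ∧
    AsympEq l (fun p => 2 * M.optimalESS A (M.ΔExactly p.1 p.2 m))
      fun p => ENNReal.ofReal (|Real.log p.1| / D) := by
  obtain ⟨V, hV, hsq⟩ := M.exists_secondMomentLE
  have h2D : 0 < 2 * D := by positivity
  have hg : Tendsto (fun p : ℝ × ℝ => |Real.log p.1| / D) l atTop :=
    (tendsto_abs_log_fst.mono_left hl).atTop_div_const hD0
  have hg2 : Tendsto (fun p : ℝ × ℝ => |Real.log p.1| / (2 * D)) l atTop :=
    (tendsto_abs_log_fst.mono_left hl).atTop_div_const h2D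
  have hlo := tendsto_one_sub_mul_sub_div hl hg (tendsto_min_div hl hr hD0) (1 / D)
  set h : ℝ × ℝ → ℝ := fun p =>
    (max |Real.log p.1| |Real.log p.2| + Real.log (m * (K - m) : ℕ)) / (2 * D) with hh
  set C : ℝ := Fintype.card (SignalNoisePair A) * (2 * √(4 * V) / (2 * D)) with hC
  have hhi : Tendsto (fun p : ℝ × ℝ => 2 * (h p + C * √(h p) + C ^ 2) / (|Real.log p.1| / D)) l
      (𝓝 1) := by
    refine (tendsto_add_sqrt_div hg2
      (tendsto_max_add_div hl hr (Real.log (m * (K - m) : ℕ)) h2D) C).congr fun p => ?_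
    change (h p + C * √(h p) + C ^ 2) / (|Real.log p.1| / (2 * D)) = _
    rw [mul_comm 2 D, ← div_div, div_div_eq_mul_div, mul_comm 2]
  have hmem := eventually_mem_Ioo_smallErrors.filter_mono hl
  have h1 : ∀ᶠ p : ℝ × ℝ in l, ENNReal.ofReal
      ((1 - (p.1 + p.2)) * (min |Real.log p.1| |Real.log p.2| / D) - 1 / D) ≤
      2 * M.optimalESS A (M.Δ p.1 p.2 (classExactly K m)) := by
    filter_upwards [hmem] with p hp
    exact M.exactly_lower_bound hD0 hD hm1 hmK hA hp.1 hp.2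
  have h2 : ∀ p : ℝ × ℝ, 2 * M.optimalESS A (M.Δ p.1 p.2 (classExactly K m)) ≤
      2 * M.optimalESS A (M.ΔExactly p.1 p.2 m) := fun p =>
    mul_le_mul_right (biInf_mono fun t ht => M.ΔExactly_subset_Δ _ _ _ ht) _
  have h3 : ∀ᶠ p : ℝ × ℝ in l, 2 * M.optimalESS A (M.ΔExactly p.1 p.2 m) ≤
      ENNReal.ofReal (2 * (h p + C * √(h p) + C ^ 2)) := by
    filter_upwards [hmem] with p hp
    rw [ENNReal.ofReal_mul zero_le_two, ENNReal.ofReal_ofNat]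
    exact mul_le_mul_right (M.exactly_upper_bound hM hV hsq hD0 hD hm1 hmK hA hp.1 hp.2) _
  constructor
  · refine asympEq_ofReal_of_le_of_le hg h1 ?_ hlo hhi
    filter_upwards [h3] with p hp using (h2 p).trans hp
  · refine asympEq_ofReal_of_le_of_le hg ?_ h3 hlo hhi
    filter_upwards [h1] with p hp using hp.trans (h2 p)

end StreamModel

end

theorem mainTheorem4 :
    -- upper bound; the constant `C` depends only on a lower bound `δ` for the information numbers
    -- and an upper bound `V` for the second moments of the log-likelihood ratios, not on `K`
    (∀ (δ V : ℝ), 0 < δ → ∃ C : ℝ, ∀ (K : ℕ) (M : StreamModel.{u} K), 1 ≤ K →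
      M.FiniteSecondMoment → M.SecondMomentLE V → (∀ k, δ ≤ M.D₀ k ∧ δ ≤ M.D₁ k) →
      ∀ A : Finset (Fin K), ∀ᶠ p : ℝ × ℝ in smallErrors,
        M.ess A (M.intersectionRule p.1 p.2).1 ≤ M.firstOrder A p.1 p.2 +
          ENNReal.ofReal (C * (K * √|Real.log (min p.1 p.2)|))) ∧
    (∀ (K : ℕ) (M : StreamModel.{u} K), 1 ≤ K → M.FiniteSecondMoment →
      -- no prior information
      (M.IsAsymptoticallyOptimal smallErrors (classBetween K 0 K) M.intersectionRule ∧
        ∀ A : Finset (Fin K),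
          AsympEq smallErrors (fun p => M.ess A (M.intersectionRule p.1 p.2).1)
            (fun p => M.firstOrder A p.1 p.2) ∧
          AsympEq smallErrors (fun p => M.firstOrder A p.1 p.2)
            (fun p => M.optimalESS A (M.Δ p.1 p.2 (classBetween K 0 K)))) ∧
      -- the symmetric case, along any way in which `α, β → 0` with `|log α| ∼ |log β|`
      (∀ (D : ℝ), (∀ k, M.D₀ k = D ∧ M.D₁ k = D) →
        ∀ l : Filter (ℝ × ℝ), l ≤ smallErrors →
        Tendsto (fun p => |Real.log p.1| / |Real.log p.2|) l (𝓝 1) →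
        (∀ ℓ u : ℕ, ℓ < u → u ≤ K →
          M.IsAsymptoticallyOptimal l (classBetween K ℓ u) M.intersectionRule ∧
          ∀ A ∈ classBetween K ℓ u,
            AsympEq l (fun p => M.ess A (M.intersectionRule p.1 p.2).1)
              (fun p => ENNReal.ofReal (|Real.log p.1| / D)) ∧
            AsympEq l (fun p => ENNReal.ofReal (|Real.log p.1| / D))
              (fun p => M.optimalESS A (M.Δ p.1 p.2 (classBetween K ℓ u)))) ∧
        (∀ m : ℕ, 1 ≤ m → m ≤ K - 1 → ∀ A ∈ classExactly K m,
          AsympEq l (fun p => M.ess A (M.intersectionRule p.1 p.2).1)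
            (fun p => ENNReal.ofReal (|Real.log p.1| / D)) ∧
          AsympEq l (fun p => ENNReal.ofReal (|Real.log p.1| / D))
            (fun p => 2 * M.optimalESS A (M.Δ p.1 p.2 (classExactly K m))) ∧
          AsympEq l (fun p => ENNReal.ofReal (|Real.log p.1| / D))
            (fun p => 2 * M.optimalESS A (M.ΔExactly p.1 p.2 m))))) := by
  -- `max V 1` replaces `V`, whose positivity is not assumed.
  refine ⟨fun δ V hδ => ⟨2 * √(max V 1) / δ * √(2 / δ) + 1, fun K M hK hM hV hD A =>
    M.eventually_ess_intersectionRule_le hK hM (by positivity) (hV.mono M (le_max_left _ _)) hδ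
      hD A⟩, fun K M hK hM => ⟨?_, fun D hD l hl hr => ?_⟩⟩
  · have hFO : ∀ (A : Finset (Fin K)) (p : ℝ × ℝ),
        M.firstOrder A p.1 p.2 = ENNReal.ofReal (M.firstOrder A p.1 p.2).toReal := fun A p =>
      (M.firstOrder_spec hK A p.1 p.2).1
    refine ⟨⟨fun α hα β hβ => M.intersectionRule_mem_Δ hK hM hα hβ _, fun A _ => ?_⟩,
      fun A => ⟨?_, ?_⟩⟩
    · exact (M.asympEq_firstOrder hK hM A).1.of_ofReal (M.tendsto_firstOrder hK A)
        (M.asympEq_firstOrder hK hM A).2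
    · simpa only [← hFO] using (M.asympEq_firstOrder hK hM A).1
    · have := (asympEq_ofReal_self (M.tendsto_firstOrder hK A)).of_ofReal
        (M.tendsto_firstOrder hK A) (M.asympEq_firstOrder hK hM A).2
      simpa only [← hFO] using this
  · have hD0 : 0 < D := (hD ⟨0, hK⟩).1 ▸ M.D₀_pos ⟨0, hK⟩
    have hg : Tendsto (fun p : ℝ × ℝ => |Real.log p.1| / D) l atTop :=
      (tendsto_abs_log_fst.mono_left hl).atTop_div_const hD0
    refine ⟨fun ℓ u hlu hu => ?_, fun m hm1 hmK A hA => ?_⟩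
    · have h : ∀ A ∈ classBetween K ℓ u, _ := fun A hA =>
        M.asympEq_symmetric hK hM hD0 hD hl hr hlu hu hA
      exact ⟨⟨fun α hα β hβ => M.intersectionRule_mem_Δ hK hM hα hβ _, fun A hA =>
        (h A hA).1.of_ofReal hg (h A hA).2⟩, fun A hA =>
        ⟨(h A hA).1, (asympEq_ofReal_self hg).of_ofReal hg (h A hA).2⟩⟩
    · have h := M.asympEq_exactly hM hD0 hD hl hr hm1 hmK hA
      -- The intersection rule does not depend on the class, so its sample size is read off from the
      -- case ℓ = 0, u = K.
      exact ⟨(M.asympEq_symmetric hK hM hD0 hD hl hr (by omega : 0 < K) le_rfl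
        (StreamModel.mem_classBetween_zero A)).1, (asympEq_ofReal_self hg).of_ofReal hg h.1,
        (asympEq_ofReal_self hg).of_ofReal hg h.2⟩
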